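/- A half-dilation is a map $z\mapsto az+b$ of $\mathbb C$ with $a\in\mathbb R\setminus\{0\}$ and $b\in\mathbb C$. For $k\ge 1$, a half-dilation $k\pi$-cone is obtained from $k$ closed upper half-planes $U_n$ ($n$ modulo $k$) by gluing $(-\infty,0]\subset U_n$ to $[0,\infty)\subset U_{n+1}$ by $z\mapsto a_nz$ with $a_n<0$. A half-dilation structure on a surface $X$ with a finite set $\Sigma$ of singularities is an atlas of $X\setminus\Sigma$ with values in $\mathbb C$ whose transition maps are locally half-dilations, such that every $p\in\Sigma$ has a neighbourhood homeomorphic to a neighbourhood of the origin of some half-dilation $k\pi$-cone, by a homeomorphism that takes $p$ to the origin and is a half-dilation in local coordinates away from $p$. A half-dilation pillowcase is a half-dilation structure on the sphere with exactly four singularities. A (minimal) triangulation of it is a finite collection of subsets $T_i\subset X$ covering $X$, each the image of a nondegenerate closed Euclidean triangle $\Delta_i$ under a continuous map $\varphi_i:\Delta_i\to X$, such that every $\varphi_i$ is injective and a local half-dilation on the interior of $\Delta_i$, the images of the interiors are pairwise disjoint, all vertices are singularities, and $T_i$ meets the singularities only at its vertices. Sides of the triangles, also of one triangle, may be glued to each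 other. For a singularity $p$, let $f(p)$ be the number of pairs $(i,v)$ of a triangle and a corner $v$ of $\Delta_i$ with $\varphi_i(v)=p$. Two triangulations have the same combinatorial type if there are a bijection between their triangles and bijections between the corners of corresponding triangles that preserve the identifications of vertices and of directed sides. **Proposition 4.2.** Every (minimal) triangulation of a triangulable half-dilation pillowcase has one of the following two combinatorial types, so that there are at most two of them: 1. the tetrahedral type $\{3,3,3,3\}$: the boundary of a tetrahedron; here $f(p)=3$ for every singularity $p$; 2. the type $\{2,2,4,4\}$: two vertices are joined by two edges, which cut the sphere into two bigons, and each bigon contains one of the other two vertices in its interior and is divided into two triangles by the two edges that join this vertex to the two vertices of the bigon; here the values of $f$, with multiplicity, are $2,2,4,4$. In particular, there is no such triangulation for which the values of $f$, with multiplicity, are $2,3,3,4$. -/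

import Mathlib

open Topology

namespace HalfDilation

/-- A half-dilation: a map `z ↦ a z + b` of `ℂ` with `a` real and nonzero and `b` complex. -/
def IsHalfDilation (h : ℂ → ℂ) : Prop :=
  ∃ (a : ℝ) (b : ℂ), a ≠ 0 ∧ ∀ z, h z = (a : ℂ) * z + b

/-- The closed upper half-plane. -/
abbrev UpperPlane : Type := {z : ℂ // 0 ≤ z.im}

/-- The gluing of `k` closed upper half-planes, with indices modulo `k`: the point `z` of
`(-∞, 0]` in the `n`-th half-plane is glued to the point `a n * z` of the half-plane `n + 1`
(which lies in `[0, ∞)` when `a n < 0`). -/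
def coneGlue (k : ℕ) [NeZero k] (a : Fin k → ℝ) (u v : Fin k × UpperPlane) : Prop :=
  (u.2 : ℂ).im = 0 ∧ (u.2 : ℂ).re ≤ 0 ∧ v.1 = u.1 + 1 ∧ (v.2 : ℂ) = (a u.1 : ℂ) * (u.2 : ℂ)

/-- The half-dilation cone of angle `k π` with gluing factors `a`, as a quotient space. -/
def Cone (k : ℕ) [NeZero k] (a : Fin k → ℝ) : Type := Quot (coneGlue k a)

instance (k : ℕ) [NeZero k] (a : Fin k → ℝ) : TopologicalSpace (Cone k a) :=
  inferInstanceAs (TopologicalSpace (Quot (coneGlue k a)))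

/-- The point of the cone given by the point `z` of the `n`-th half-plane. -/
def Cone.mk (k : ℕ) [NeZero k] (a : Fin k → ℝ) (n : Fin k) (z : UpperPlane) : Cone k a :=
  Quot.mk _ (n, z)

/-- The origin of the cone. -/
def Cone.apex (k : ℕ) [NeZero k] (a : Fin k → ℝ) : Cone k a :=
  Cone.mk k a 0 ⟨0, le_refl _⟩

/-- The point `p` has a neighbourhood that is homeomorphic to a neighbourhood of the origin of a
half-dilation cone of angle `k π`, by a homeomorphism `e` that takes `p` to the origin and is a
half-dilation in local coordinates away from `p`.

The coordinates of the cone are those of its closed half-planes.  At a point on a gluing ray the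
condition is imposed from the two half-planes that meet there; since the two affine expressions
agree along the ray, they fit together to one half-dilation in the coordinate that continues the
one half-plane across the ray by means of the gluing map. -/
def IsConePoint {X : Type*} [TopologicalSpace X] (sing : Finset X)
    (charts : Set (OpenPartialHomeomorph X ℂ)) (p : X) : Prop :=
  ∃ (k : ℕ) (_ : NeZero k) (a : Fin k → ℝ) (e : OpenPartialHomeomorph X (Cone k a)),
    (∀ n, a n < 0) ∧
    p ∈ e.source ∧ e p = Cone.apex k a ∧
    (∀ q ∈ sing, q ∈ e.source → q = p) ∧
    ∀ (n : Fin k) (z : UpperPlane), (z : ℂ) ≠ 0 → Cone.mk k a n z ∈ e.target →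
      ∀ c ∈ charts, e.symm (Cone.mk k a n z) ∈ c.source →
        ∃ h : ℂ → ℂ, IsHalfDilation h ∧
          ∀ᶠ w : UpperPlane in 𝓝 z, c (e.symm (Cone.mk k a n w)) = h w

/-- A half-dilation structure on `X` with a finite set of singularities. -/
structure HalfDilationStructure (X : Type*) [TopologicalSpace X] where
  /-- the singularities -/
  sing : Finset X
  /-- the charts, defined on open subsets of the complement of the singularities -/
  charts : Set (OpenPartialHomeomorph X ℂ)
  /-- the domains of the charts cover exactly the complement of the singularities -/
  cover : ∀ x, (∃ c ∈ charts, x ∈ c.source) ↔ x ∉ sing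
  /-- the transition maps are, locally, half-dilations -/
  transition : ∀ c ∈ charts, ∀ c' ∈ charts, ∀ x ∈ c.source ∩ c'.source,
    ∃ h : ℂ → ℂ, IsHalfDilation h ∧ ∀ᶠ y in 𝓝 x, c' y = h (c y)
  /-- each singularity has a neighbourhood modelled on a half-dilation cone -/
  cone : ∀ p ∈ sing, IsConePoint sing charts p

/-- A half-dilation pillowcase: a half-dilation structure on the sphere with exactly four
singularities. -/
structure HalfDilationStructure.IsPillowcase {X : Type*} [TopologicalSpace X]
    (H : HalfDilationStructure X) : Prop where
  sphere : Nonempty (X ≃ₜ Metric.sphere (0 : EuclideanSpace ℝ (Fin 3)) 1)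
  four : H.sing.card = 4

/-- A triangulation of a half-dilation surface by `n` triangles, with vertices exactly at
singularities.  The `i`-th triangle of the surface is the image `map i '' tri i` of a closed
Euclidean triangle `tri i` with corners `corner i 0`, `corner i 1`, `corner i 2`.  Sides of triangles
(of one triangle, or of several) may be glued to each other. Values of `map i` outside the
triangle play no role. -/
structure Triangulation {X : Type*} [TopologicalSpace X] (H : HalfDilationStructure X) where
  /-- the number of triangles -/
  n : ℕ
  /-- the corners of the Euclidean triangles -/
  corner : Fin n → Fin 3 → ℂ
  /-- the Euclidean triangles are not degenerate -/
  nondegenerate : ∀ i, AffineIndependent ℝ (corner i)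
  /-- the parametrizations of the triangles of the surface -/
  map : Fin n → ℂ → X
  continuousOn : ∀ i, ContinuousOn (map i) (convexHull ℝ (Set.range (corner i)))
  /-- the open triangles are embedded -/
  injOn : ∀ i, Set.InjOn (map i) (interior (convexHull ℝ (Set.range (corner i))))
  /-- the parametrizations of the open triangles are local half-dilations -/
  halfDilation : ∀ i, ∀ z ∈ interior (convexHull ℝ (Set.range (corner i))),
    ∀ c ∈ H.charts, map i z ∈ c.source →
      ∃ h : ℂ → ℂ, IsHalfDilation h ∧ ∀ᶠ w in 𝓝 z, c (map i w) = h w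
  /-- the open triangles are pairwise disjoint -/
  disjoint : ∀ i j, i ≠ j →
    Disjoint (map i '' interior (convexHull ℝ (Set.range (corner i))))
      (map j '' interior (convexHull ℝ (Set.range (corner j))))
  /-- the triangles cover the surface -/
  cover : ∀ x, ∃ i, x ∈ map i '' convexHull ℝ (Set.range (corner i))
  /-- all vertices are singularities -/
  vertex_mem : ∀ i j, map i (corner i j) ∈ H.sing
  /-- a triangle meets the singularities only at its vertices -/
  sing_vertex : ∀ i, ∀ z ∈ convexHull ℝ (Set.range (corner i)),
    map i z ∈ H.sing → z ∈ Set.range (corner i)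

/-- The combinatorial data of a triangulation: a set of triangles, each with corners `0, 1, 2`;
when two corners are the same vertex; and when two directed sides are the same directed edge.
`edge f a b g c d` says that the side of `f` from corner `a` to corner `b` is glued to
the side of `g` from corner `c` to corner `d`, with these directions matching
(only `a ≠ b` and `c ≠ d` are meaningful). -/
structure Scheme where
  Face : Type
  vertex : Face → Fin 3 → Face → Fin 3 → Prop
  edge : Face → Fin 3 → Fin 3 → Face → Fin 3 → Fin 3 → Prop

/-- Two schemes are of the same combinatorial type: there are a bijection of the triangles and
bijections of the corners of corresponding triangles that respect the identifications of vertices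
and of directed sides. -/
def Scheme.SameType (S S' : Scheme) : Prop :=
  ∃ (e : S.Face ≃ S'.Face) (σ : S.Face → Equiv.Perm (Fin 3)),
    (∀ f a g c, S.vertex f a g c ↔ S'.vertex (e f) (σ f a) (e g) (σ g c)) ∧
    ∀ f a b g c d, a ≠ b → c ≠ d →
      (S.edge f a b g c d ↔ S'.edge (e f) (σ f a) (σ f b) (e g) (σ g c) (σ g d))

/-- The combinatorial data of a triangulation of a half-dilation surface: two corners are the same
vertex if they have the same image; two directed sides are the same edge if their affine
parametrizations by `[0, 1]` have the same image, point by point. -/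
def Triangulation.scheme {X : Type*} [TopologicalSpace X] {H : HalfDilationStructure X}
    (T : Triangulation H) : Scheme where
  Face := Fin T.n
  vertex f a g c := T.map f (T.corner f a) = T.map g (T.corner g c)
  edge f a b g c d := ∀ t ∈ Set.Icc (0 : ℝ) 1,
    T.map f (AffineMap.lineMap (T.corner f a) (T.corner f b) t) =
      T.map g (AffineMap.lineMap (T.corner g c) (T.corner g d) t)

/-- The number of faces around the point `p`, that is, of corners of triangles that lie at `p`. -/
noncomputable def Triangulation.degree {X : Type*} [TopologicalSpace X]
    {H : HalfDilationStructure X} (T : Triangulation H) (p : X) : ℕ :=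
  Nat.card {c : Fin T.n × Fin 3 // T.map c.1 (T.corner c.1 c.2) = p}

/-- The multiset of the numbers of faces around the singularities. -/
noncomputable def Triangulation.degrees {X : Type*} [TopologicalSpace X]
    {H : HalfDilationStructure X} (T : Triangulation H) : Multiset ℕ :=
  H.sing.val.map T.degree

/-- The scheme with four triangles that is given by the names `v f a` of the vertices (at the
corner `a` of `f`) and the names `s f j` of the undirected edges (at the side of `f` opposite the
corner `j`).  The corner opposite the side from `a` to `b` is `-(a + b)` modulo `3`. -/
def Scheme.ofNames (v : Fin 4 → Fin 3 → Fin 4) (s : Fin 4 → Fin 3 → Fin 6) : Scheme where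
  Face := Fin 4
  vertex f a g c := v f a = v g c
  edge f a b g c d := s f (-(a + b)) = s g (-(c + d)) ∧ v f a = v g c ∧ v f b = v g d

/-- The boundary of a tetrahedron with vertices `0, 1, 2, 3`; its edges
`01, 02, 03, 12, 13, 23` are named `0, 1, 2, 3, 4, 5`. -/
def Scheme.tetrahedral : Scheme :=
  Scheme.ofNames
    ![![1, 2, 3], ![0, 2, 3], ![0, 1, 3], ![0, 1, 2]]
    ![![5, 4, 3], ![5, 2, 1], ![4, 2, 0], ![3, 1, 0]]

/-- The scheme with vertices `0, 1, 2, 3` in which `0` and `1` are joined by two edges,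
named `0` and `1`.  They cut the sphere into two bigons; one is divided into two triangles by the
edges `12` and `02` (named `2` and `3`) from its inner vertex `2`, the other by the edges `13` and
`03` (named `4` and `5`) from its inner vertex `3`. -/
def Scheme.twoBigons : Scheme :=
  Scheme.ofNames
    ![![0, 1, 2], ![0, 1, 2], ![0, 1, 3], ![0, 1, 3]]
    ![![2, 3, 0], ![2, 3, 1], ![4, 5, 0], ![4, 5, 1]]

end HalfDilation

/-!
The gluing maps of half-dilation surfaces are real multiples in local coordinates, so they
preserve the directions of lines. This has two consequences for a triangulation. Every side of a
triangle is glued to exactly one other side, by the affine map that reverses its orientation: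
around a nonsingular point of a side, the triangles are half-planes in a chart, and as they do not
overlap and cover a neighbourhood, there are two of them, on opposite sides of a line
(`Triangulation.existsUnique_partner`, `Triangulation.exists_isGluing`). And glued sides are
parallel, so two sides of the same triangle are never glued to each other (`IsGluing.face_ne`).

The number of triangles is found by Euler's formula. An integral cellular `1`-cocycle defines
affine functions on the triangles, which fit together to a map from the sphere to the circle. Such
a map lifts to the line (`exists_lift_sphere`), and the values of the lift at the vertices show
that the cocycle is a coboundary (`IsGluing.exists_potential`). The complement of the
singularities is connected, and so the dimensions of the spaces of cochains determine the Euler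
characteristic (`TriangleGluing.card_faces`): with four vertices, there are four triangles.

The rest is combinatorial (`TriangleGluing.hasNames_or`). No vertex has a single triangle around
it, as two sides of this triangle would be glued. If there is a vertex with two triangles around
it, they form a bigon, and the two remaining triangles form the other bigon, since the alternative
gluings of these have too few vertices or are not connected. Otherwise every vertex has at least
three triangles around it, and since the four triangles have twelve corners, it has exactly three.
This determines the gluing to be that of a tetrahedron.
-/

namespace HalfDilation

/-! ### Topology of the sphere -/

/-- The unit sphere of Euclidean three-space. -/
abbrev Sphere2 : Type := Metric.sphere (0 : EuclideanSpace ℝ (Fin 3)) 1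

instance : Fact (Module.finrank ℝ (EuclideanSpace ℝ (Fin 3)) = 2 + 1) := ⟨by simp⟩

/-- A continuous function on a preconnected set that differs from another one by integers
differs from it by a constant. -/
theorem exists_int_of_coe_eq {X : Type*} [TopologicalSpace X] {s : Set X} (hs : IsPreconnected s)
    {g h : X → ℝ} (hg : ContinuousOn g s) (hh : ContinuousOn h s)
    (he : ∀ x ∈ s, (g x : AddCircle (1 : ℝ)) = h x) :
    ∃ m : ℤ, ∀ x ∈ s, g x = h x + m := by
  have key : ∀ x ∈ s, ∃ m : ℤ, (m : ℝ) = g x - h x := by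
    intro x hx
    obtain ⟨m, hm⟩ := (AddCircle.coe_eq_zero_iff (1 : ℝ) (x := g x - h x)).1 (by
      rw [AddCircle.coe_sub, he x hx, sub_self])
    exact ⟨m, by simpa using hm⟩
  rcases s.eq_empty_or_nonempty with rfl | ⟨x₀, hx₀⟩
  · exact ⟨0, by simp⟩
  obtain ⟨m, hm⟩ := key x₀ hx₀
  refine ⟨m, fun x hx => ?_⟩
  have hmaps : Set.MapsTo (fun x => g x - h x) s (Set.range ((↑) : ℤ → ℝ)) := key
  have hdisc : DiscreteTopology (Set.range ((↑) : ℤ → ℝ)) :=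
    (Int.isClosedEmbedding_coe_real.isEmbedding.toHomeomorph).discreteTopology
  have := hs.constant_of_mapsTo ⟨hdisc⟩ (hg.sub hh) hmaps hx hx₀
  simp only [Pi.sub_apply] at this
  linarith

/-- Lifts of a circle-valued function on two open sets that cover the space and have a connected
intersection can be fitted together. -/
theorem exists_lift_of_union {X : Type*} [TopologicalSpace X] {U V : Set X} (hU : IsOpen U)
    (hV : IsOpen V) (hUV : U ∪ V = Set.univ) (hc : IsPreconnected (U ∩ V))
    {f : X → AddCircle (1 : ℝ)}
    (hfU : ∃ g : X → ℝ, ContinuousOn g U ∧ ∀ x ∈ U, (g x : AddCircle (1 : ℝ)) = f x)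
    (hfV : ∃ g : X → ℝ, ContinuousOn g V ∧ ∀ x ∈ V, (g x : AddCircle (1 : ℝ)) = f x) :
    ∃ g : X → ℝ, Continuous g ∧ ∀ x, (g x : AddCircle (1 : ℝ)) = f x := by
  classical
  obtain ⟨g, hg, hgf⟩ := hfU
  obtain ⟨h, hh, hhf⟩ := hfV
  obtain ⟨m, hm⟩ := exists_int_of_coe_eq hc (hg.mono Set.inter_subset_left)
    (hh.mono Set.inter_subset_right) (fun x hx => (hgf x hx.1).trans (hhf x hx.2).symm)
  have hm1 : ((m : ℝ) : AddCircle (1 : ℝ)) = 0 :=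
    (AddCircle.coe_eq_zero_iff (1 : ℝ)).2 ⟨m, by simp⟩
  let G : X → ℝ := fun x => if x ∈ U then g x else h x + m
  have GU : Set.EqOn G g U := fun x hx => if_pos hx
  have GV : Set.EqOn G (fun x => h x + m) V := fun x hx => by
    by_cases hxU : x ∈ U
    · simp only [G, if_pos hxU, hm x ⟨hxU, hx⟩]
    · simp only [G, if_neg hxU]
  refine ⟨G, ?_, fun x => ?_⟩
  · rw [← continuousOn_univ, ← hUV]
    exact (hg.congr GU).union_of_isOpen ((hh.add continuousOn_const).congr GV) hU hV
  · rcases (hUV ▸ Set.mem_univ x : x ∈ U ∪ V) with hx | hx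
    · rw [GU hx, hgf x hx]
    · rw [GV hx]
      simp only [AddCircle.coe_add, hm1, add_zero, hhf x hx]

/-- The complement of a point of the sphere is a plane, so circle-valued functions lift there. -/
theorem exists_lift_sphere_compl (v : Sphere2) {f : Sphere2 → AddCircle (1 : ℝ)}
    (hf : Continuous f) : ∃ g : Sphere2 → ℝ, ContinuousOn g {v}ᶜ ∧
      ∀ x ∈ ({v}ᶜ : Set Sphere2), (g x : AddCircle (1 : ℝ)) = f x := by
  let φ := stereographic' (E := EuclideanSpace ℝ (Fin 3)) 2 v
  have hφs : φ.source = {v}ᶜ := stereographic'_source v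
  have hφt : φ.target = Set.univ := stereographic'_target v
  have hcont : Continuous φ.symm := by
    rw [← continuousOn_univ, ← hφt]; exact φ.continuousOn_symm
  obtain ⟨e₀, he₀⟩ := QuotientAddGroup.mk_surjective (f (φ.symm 0))
  obtain ⟨F, ⟨-, hF⟩, -⟩ := (AddCircle.isCoveringMap_coe (1 : ℝ)).existsUnique_continuousMap_lifts
    (A := EuclideanSpace ℝ (Fin 2)) ⟨fun x => f (φ.symm x), hf.comp hcont⟩ 0 e₀ he₀
  refine ⟨fun x => F (φ x), ?_, fun x hx => ?_⟩
  · rw [← hφs]; exact F.continuous.comp_continuousOn φ.continuousOn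
  · have := congrFun hF (φ x)
    simp only [Function.comp_apply, ContinuousMap.coe_mk] at this
    rw [this, φ.left_inv (hφs ▸ hx)]

/-- After removing one point of the finite set, this is the complement of a finite set in the
plane. -/
theorem isPreconnected_sphere_compl {s : Set Sphere2} (hs : s.Finite) (hne : s.Nonempty) :
    IsPreconnected sᶜ := by
  obtain ⟨v, hv⟩ := hne
  let φ := stereographic' (E := EuclideanSpace ℝ (Fin 3)) 2 v
  have hφs : φ.source = {v}ᶜ := stereographic'_source v
  have hφt : φ.target = Set.univ := stereographic'_target v
  have hcont : Continuous φ.symm := by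
    rw [← continuousOn_univ, ← hφt]; exact φ.continuousOn_symm
  have h1 : IsPreconnected (φ '' (s ∩ {v}ᶜ))ᶜ := by
    refine (((hs.inter_of_left _).image φ).countable.isConnected_compl_of_one_lt_rank
      ?_).isPreconnected
    rw [← Module.finrank_eq_rank]; simp
  have h2 : φ.symm '' (φ '' (s ∩ {v}ᶜ))ᶜ = sᶜ := by
    ext x
    constructor
    · rintro ⟨y, hy, rfl⟩ hx
      have hy' : y ∈ φ.target := hφt ▸ Set.mem_univ y
      exact hy ⟨φ.symm y, ⟨hx, hφs ▸ φ.map_target hy'⟩, φ.right_inv hy'⟩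
    · intro hx
      have hxv : x ∈ φ.source := by
        rw [hφs]; rintro rfl; exact hx hv
      refine ⟨φ x, ?_, φ.left_inv hxv⟩
      rintro ⟨y, ⟨hy, hyv⟩, hyx⟩
      have : y = x := φ.injOn (hφs ▸ hyv) hxv hyx
      exact hx (this ▸ hy)
  rw [← h2]
  exact h1.image _ hcont.continuousOn

/-- Every map from the sphere to the circle lifts to the line, since it lifts on the complements
of two antipodal points and these have a connected intersection. -/
theorem exists_lift_sphere {f : Sphere2 → AddCircle (1 : ℝ)} (hf : Continuous f) :
    ∃ g : Sphere2 → ℝ, Continuous g ∧ ∀ x, (g x : AddCircle (1 : ℝ)) = f x := by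
  obtain ⟨v⟩ : Nonempty Sphere2 := (NormedSpace.sphere_nonempty.2 zero_le_one).to_subtype
  have hv : v ≠ -v := ne_neg_of_mem_unit_sphere ℝ v
  refine exists_lift_of_union (U := {v}ᶜ) (V := {-v}ᶜ) isOpen_compl_singleton
    isOpen_compl_singleton ?_ ?_ (exists_lift_sphere_compl v hf) (exists_lift_sphere_compl (-v) hf)
  · refine Set.eq_univ_of_forall fun x => ?_
    by_cases h : x = v
    · exact Or.inr fun h' => hv (h.symm.trans h')
    · exact Or.inl h
  · rw [← Set.compl_union]
    exact isPreconnected_sphere_compl (by simp) (by simp)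

theorem exists_lift_of_homeomorph_sphere {X : Type*} [TopologicalSpace X] (e : X ≃ₜ Sphere2)
    {f : X → AddCircle (1 : ℝ)} (hf : Continuous f) :
    ∃ g : X → ℝ, Continuous g ∧ ∀ x, (g x : AddCircle (1 : ℝ)) = f x := by
  obtain ⟨g, hg, h⟩ := exists_lift_sphere (hf.comp e.symm.continuous)
  exact ⟨g ∘ e, hg.comp e.continuous, fun x => by simp [h]⟩

theorem isPreconnected_compl_of_homeomorph_sphere {X : Type*} [TopologicalSpace X]
    (e : X ≃ₜ Sphere2) {s : Set X} (hs : s.Finite) (hne : s.Nonempty) : IsPreconnected sᶜ := by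
  have h := isPreconnected_sphere_compl (hs.image e) (hne.image e)
  rw [← Set.image_compl_eq e.bijective] at h
  exact (e.isPreconnected_image).1 h

/-! ### Plane geometry of a triangle -/

/-- The determinant of two vectors of the plane. -/
def cross (u v : ℂ) : ℝ := u.re * v.im - u.im * v.re

theorem cross_sub_right (u v w : ℂ) : cross u (v - w) = cross u v - cross u w := by
  simp only [cross, Complex.sub_re, Complex.sub_im]; ring

theorem cross_real_mul_right (u v : ℂ) (r : ℝ) : cross u (r * v) = r * cross u v := by
  simp [cross]; ring

theorem cross_real_mul_left (u v : ℂ) (r : ℝ) : cross (r * u) v = r * cross u v := by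
  simp [cross]; ring

theorem cross_self (u : ℂ) : cross u u = 0 := by
  simp [cross]; ring

theorem cross_I_mul_pos {u : ℂ} (hu : u ≠ 0) : 0 < cross u (Complex.I * u) := by
  have := Complex.normSq_pos.2 hu
  rw [Complex.normSq_apply] at this
  simpa [cross] using this

/-- Two open half-planes through the origin that do not meet are opposite to each other. -/
theorem exists_neg_mul_of_disjoint_halfPlanes {D D' : ℂ} (hD : D ≠ 0) (hD' : D' ≠ 0)
    (h : ∀ u, ¬ (0 < cross D u ∧ 0 < cross D' u)) : ∃ r : ℝ, 0 < r ∧ D' = -(r * D) := by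
  have hc : cross D D' = 0 := by
    by_contra hc
    -- `u` has determinant `1` with both vectors
    refine h (((cross D D')⁻¹ : ℝ) * (D' - D)) ⟨?_, ?_⟩
    · rw [cross_real_mul_right, cross_sub_right, cross_self, sub_zero, inv_mul_cancel₀ hc]
      exact one_pos
    · have : cross D' D = - cross D D' := by simp only [cross]; ring
      rw [cross_real_mul_right, cross_sub_right, cross_self, this, zero_sub, neg_neg,
        inv_mul_cancel₀ hc]
      exact one_pos
  have hn : 0 < D.re * D.re + D.im * D.im := by
    have := Complex.normSq_pos.2 hD
    rwa [Complex.normSq_apply] at this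
  obtain ⟨l, hl⟩ : ∃ l : ℝ, D' = l * D := by
    refine ⟨(D'.re * D.re + D'.im * D.im) / (D.re * D.re + D.im * D.im), ?_⟩
    simp only [cross] at hc
    apply Complex.ext
    · simp only [Complex.mul_re, Complex.ofReal_re, Complex.ofReal_im, zero_mul, sub_zero]
      rw [div_mul_eq_mul_div]
      rw [eq_div_iff hn.ne']
      linear_combination (-D.im) * hc
    · simp only [Complex.mul_im, Complex.ofReal_re, Complex.ofReal_im, zero_mul, add_zero]
      rw [div_mul_eq_mul_div]
      rw [eq_div_iff hn.ne']
      linear_combination D.re * hc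
  refine ⟨-l, ?_, by rw [hl]; push_cast; ring⟩
  by_contra hl'
  have hl0 : l ≠ 0 := by rintro rfl; simp at hl; exact hD' hl
  have hlp : 0 < l := lt_of_le_of_ne (by linarith) hl0.symm
  exact h (Complex.I * D) ⟨cross_I_mul_pos hD, by
    rw [hl, cross_real_mul_left]; exact mul_pos hlp (cross_I_mul_pos hD)⟩

/-- A function on a connected open set that is affine near every point is affine. -/
theorem eqOn_affine_of_locally_affine {𝕜 : Type*} [RCLike 𝕜] {U : Set 𝕜} (hU : IsPreconnected U)
    {f : 𝕜 → 𝕜} (hf : ∀ z ∈ U, ∃ a b : 𝕜, ∀ᶠ w in 𝓝 z, f w = a * w + b)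
    {z₀ : 𝕜} (hz₀ : z₀ ∈ U) {a b : 𝕜} (h : ∀ᶠ w in 𝓝 z₀, f w = a * w + b) :
    ∀ w ∈ U, f w = a * w + b := by
  have han : ∀ (a b : 𝕜) (z : 𝕜), AnalyticAt 𝕜 (fun w => a * w + b) z := fun a b z => by fun_prop
  have h1 : AnalyticOnNhd 𝕜 f U := fun z hz => by
    obtain ⟨a, b, hab⟩ := hf z hz
    exact (han a b z).congr (hab.mono fun w hw => hw.symm)
  exact h1.eqOn_of_preconnected_of_eventuallyEq (fun z _ => han a b z) hU hz₀ h

/-- The corners of a nondegenerate triangle as an affine basis of the plane. -/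
noncomputable def triangleBasis {q : Fin 3 → ℂ} (hq : AffineIndependent ℝ q)
    : AffineBasis (Fin 3) ℝ ℂ where
  toFun := q
  ind' := hq
  tot' := hq.affineSpan_eq_top_iff_card_eq_finrank_add_one.2 (by
    rw [Complex.finrank_real_complex]; simp)

/-- The barycentric coordinates of a nondegenerate triangle. -/
noncomputable def bary {q : Fin 3 → ℂ} (hq : AffineIndependent ℝ q)
    (k : Fin 3) : ℂ →ᵃ[ℝ] ℝ := (triangleBasis hq).coord k

theorem continuous_bary {q : Fin 3 → ℂ} (hq : AffineIndependent ℝ q)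
    (k : Fin 3) : Continuous (bary hq k) :=
  continuous_barycentric_coord _ _

theorem bary_corner {q : Fin 3 → ℂ} (hq : AffineIndependent ℝ q)
    (k l : Fin 3) : bary hq k (q l) = if k = l then 1 else 0 :=
  (triangleBasis hq).coord_apply k l

theorem sum_bary {q : Fin 3 → ℂ} (hq : AffineIndependent ℝ q)
    (z : ℂ) : bary hq 0 z + bary hq 1 z + bary hq 2 z = 1 := by
  have := (triangleBasis hq).sum_coord_apply_eq_one z
  rwa [Fin.sum_univ_three] at this

theorem sum_bary_mul {q : Fin 3 → ℂ} (hq : AffineIndependent ℝ q) (z : ℂ) :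
    (bary hq 0 z : ℂ) * q 0 + bary hq 1 z * q 1 + bary hq 2 z * q 2 = z := by
  have := (triangleBasis hq).linear_combination_coord_eq_self z
  rw [Fin.sum_univ_three] at this
  simp only [Complex.real_smul] at this
  exact this

theorem mem_triangle_iff {q : Fin 3 → ℂ} (hq : AffineIndependent ℝ q)
    {z : ℂ} : z ∈ convexHull ℝ (Set.range q) ↔ ∀ k, 0 ≤ bary hq k z := by
  have := (triangleBasis hq).convexHull_eq_nonneg_coord
  change convexHull ℝ (Set.range q) = _ at this
  rw [this]; rfl

theorem mem_interior_triangle_iff {q : Fin 3 → ℂ} (hq : AffineIndependent ℝ q) {z : ℂ} :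
    z ∈ interior (convexHull ℝ (Set.range q)) ↔ ∀ k, 0 < bary hq k z := by
  have := (triangleBasis hq).interior_convexHull
  change interior (convexHull ℝ (Set.range q)) = _ at this
  rw [this]; rfl

theorem triangle_subset_closure_interior {q : Fin 3 → ℂ} (hq : AffineIndependent ℝ q) :
    convexHull ℝ (Set.range q) ⊆ closure (interior (convexHull ℝ (Set.range q))) := by
  rw [(convex_convexHull ℝ (Set.range q)).closure_interior_eq_closure_of_nonempty_interior]
  · exact subset_closure
  · rw [interior_convexHull_nonempty_iff_affineSpan_eq_top]
    exact (triangleBasis hq).tot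

theorem isCompact_triangle (q : Fin 3 → ℂ) : IsCompact (convexHull ℝ (Set.range q)) :=
  (Set.finite_range q).isCompact_convexHull ℝ

/-- The point of the side from the corner `j` to the corner `j + 1` with parameter `t`. -/
noncomputable def sidePoint (q : Fin 3 → ℂ) (j : Fin 3) (t : ℝ) : ℂ :=
  AffineMap.lineMap (q j) (q (j + 1)) t

theorem sidePoint_eq (q : Fin 3 → ℂ) (j : Fin 3) (t : ℝ) :
    sidePoint q j t = q j + t * (q (j + 1) - q j) := by
  simp [sidePoint, AffineMap.lineMap_apply, add_comm]

theorem sidePoint_zero (q : Fin 3 → ℂ) (j : Fin 3) : sidePoint q j 0 = q j := by simp [sidePoint]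

theorem sidePoint_one (q : Fin 3 → ℂ) (j : Fin 3) : sidePoint q j 1 = q (j + 1) := by
  simp [sidePoint]

theorem continuous_sidePoint (q : Fin 3 → ℂ) (j : Fin 3) : Continuous (sidePoint q j) :=
  AffineMap.lineMap_continuous

theorem sidePoint_sub (q : Fin 3 → ℂ) (j : Fin 3) (t r : ℝ) :
    sidePoint q j r - sidePoint q j t = ((r - t : ℝ) : ℂ) * (q (j + 1) - q j) := by
  rw [sidePoint_eq, sidePoint_eq]; push_cast; ring

theorem sidePoint_mem (q : Fin 3 → ℂ) (j : Fin 3) {t : ℝ} (ht : t ∈ Set.Icc (0 : ℝ) 1) :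
    sidePoint q j t ∈ convexHull ℝ (Set.range q) :=
  (convex_convexHull ℝ _).lineMap_mem (subset_convexHull ℝ _ (Set.mem_range_self j))
    (subset_convexHull ℝ _ (Set.mem_range_self (j + 1))) ht

theorem bary_sidePoint {q : Fin 3 → ℂ} (hq : AffineIndependent ℝ q) (k j : Fin 3) (t : ℝ) :
    bary hq k (sidePoint q j t) =
      (1 - t) * (if k = j then 1 else 0) + t * (if k = j + 1 then 1 else 0) := by
  rw [sidePoint, AffineMap.apply_lineMap, AffineMap.lineMap_apply_ring, bary_corner, bary_corner]

theorem fin3_cases (k j : Fin 3) : k = j ∨ k = j + 1 ∨ k = j + 2 := by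
  revert k j; decide

theorem fin3_ne (j : Fin 3) :
    j + 1 ≠ j ∧ j + 2 ≠ j ∧ j + 2 ≠ j + 1 ∧ j ≠ j + 1 ∧ j ≠ j + 2 ∧ j + 1 ≠ j + 2 := by
  revert j; decide

theorem bary_ext {q : Fin 3 → ℂ} (hq : AffineIndependent ℝ q)
    {z w : ℂ} (h : ∀ k, bary hq k z = bary hq k w) : z = w :=
  (triangleBasis hq).ext_elem h

theorem sum_bary' {q : Fin 3 → ℂ} (hq : AffineIndependent ℝ q) (j : Fin 3) (z : ℂ) :
    bary hq j z + bary hq (j + 1) z + bary hq (j + 2) z = 1 := by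
  have h := sum_bary hq z
  fin_cases j <;> simp <;> linarith

theorem sidePoint_bary {q : Fin 3 → ℂ} (hq : AffineIndependent ℝ q)
    {z : ℂ} {j : Fin 3} (h : bary hq (j + 2) z = 0) :
    z = sidePoint q j (bary hq (j + 1) z) := by
  have hs := sum_bary' hq j z
  obtain ⟨h1, h2, h3, h4, h5, h6⟩ := fin3_ne j
  refine bary_ext hq fun k => ?_
  rw [bary_sidePoint]
  rcases fin3_cases k j with rfl | rfl | rfl <;> simp [h1, h2, h4] <;> linarith

/-- A point of a triangle is an interior point, a corner, or lies on an open side. -/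
theorem triangle_cases {q : Fin 3 → ℂ} (hq : AffineIndependent ℝ q)
    {z : ℂ} (hz : z ∈ convexHull ℝ (Set.range q)) :
    z ∈ interior (convexHull ℝ (Set.range q)) ∨ z ∈ Set.range q ∨
      ∃ j, ∃ t ∈ Set.Ioo (0 : ℝ) 1, z = sidePoint q j t := by
  by_cases hi : z ∈ interior (convexHull ℝ (Set.range q))
  · exact Or.inl hi
  refine Or.inr ?_
  rw [mem_triangle_iff hq] at hz
  rw [mem_interior_triangle_iff hq] at hi
  push Not at hi
  obtain ⟨k, hk⟩ := hi
  obtain ⟨j, rfl⟩ : ∃ j, k = j + 2 := ⟨k + 1, by clear hk; revert k; decide⟩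
  have h0 := le_antisymm hk (hz _)
  have hs := sum_bary' hq j z
  have hzj := sidePoint_bary hq h0
  rcases (hz (j + 1)).eq_or_lt' with h1 | h1
  · rw [h1, sidePoint_zero] at hzj
    exact Or.inl ⟨j, hzj.symm⟩
  rcases (hz j).eq_or_lt' with h2 | h2
  · rw [show bary hq (j + 1) z = 1 by linarith, sidePoint_one] at hzj
    exact Or.inl ⟨j + 1, hzj.symm⟩
  · exact Or.inr ⟨j, _, ⟨h1, by linarith⟩, hzj⟩

theorem sidePoint_notMem_range {q : Fin 3 → ℂ} (hq : AffineIndependent ℝ q)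
    {j : Fin 3} {t : ℝ} (ht : t ∈ Set.Ioo (0 : ℝ) 1) :
    sidePoint q j t ∉ Set.range q := by
  rintro ⟨l, hl⟩
  have h := fin3_ne j
  have h1 := bary_corner hq j l
  have h2 := bary_corner hq (j + 1) l
  rw [hl, bary_sidePoint] at h1 h2
  have := ht.1; have := ht.2
  simp only [if_pos, h] at h1 h2
  by_cases e1 : j = l
  · simp [e1] at h1
    linarith
  · by_cases e2 : j + 1 = l
    · simp [e2] at h2
      linarith
    · simp [e1] at h1
      linarith

/-- Two parametrizations of points of open sides agree only if sides and parameters agree. -/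
theorem sidePoint_injective {q : Fin 3 → ℂ} (hq : AffineIndependent ℝ q)
    {j j' : Fin 3} {t t' : ℝ} (ht : t ∈ Set.Ioo (0 : ℝ) 1)
    (ht' : t' ∈ Set.Ioo (0 : ℝ) 1) (h : sidePoint q j t = sidePoint q j' t') :
    j = j' ∧ t = t' := by
  have h0 := fun k => congrArg (bary hq k) h
  simp only [bary_sidePoint] at h0
  have hn := fin3_ne j'
  have := ht.1; have := ht.2; have := ht'.1; have := ht'.2
  rcases fin3_cases j j' with rfl | rfl | rfl
  · have := h0 (j + 1)
    simp [hn] at this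
    exact ⟨rfl, this⟩
  · have := h0 j'
    have e : (j' + 1 + 1 : Fin 3) ≠ j' := by simp [add_assoc]
    simp [hn, e.symm] at this
    linarith
  · have := h0 (j' + 2)
    have e : (j' + 2 + 1 : Fin 3) ≠ j' + 2 := by simp
    simp [hn, e.symm] at this
    linarith

theorem side_ne_zero {q : Fin 3 → ℂ} (hq : AffineIndependent ℝ q)
    (j : Fin 3) : q (j + 1) - q j ≠ 0 :=
  sub_ne_zero.2 fun h => (fin3_ne j).1 (hq.injective h)

theorem cross_side {q : Fin 3 → ℂ} (hq : AffineIndependent ℝ q) (j : Fin 3) (z : ℂ) :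
    cross (q (j + 1) - q j) (z - q j) =
      bary hq (j + 2) z * cross (q (j + 1) - q j) (q (j + 2) - q j) := by
  have h := sum_bary_mul hq z
  have hs := sum_bary hq z
  have hre := congrArg Complex.re h
  have him := congrArg Complex.im h
  simp only [Complex.add_re, Complex.add_im, Complex.mul_re, Complex.mul_im, Complex.ofReal_re,
    Complex.ofReal_im, zero_mul, sub_zero, add_zero] at hre him
  have h0 : bary hq 0 z = 1 - bary hq 1 z - bary hq 2 z := by linarith
  simp only [cross, Complex.sub_re, Complex.sub_im, ← hre, ← him]
  fin_cases j <;> simp <;> rw [h0] <;> ring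

theorem cross_side_ne_zero {q : Fin 3 → ℂ} (hq : AffineIndependent ℝ q)
    (j : Fin 3) : cross (q (j + 1) - q j) (q (j + 2) - q j) ≠ 0 := by
  intro h
  have h1 := cross_side hq j (q j + Complex.I * (q (j + 1) - q j))
  rw [h, mul_zero, add_sub_cancel_left] at h1
  exact (cross_I_mul_pos (side_ne_zero hq j)).ne' h1

/-- Distinct sides of a nondegenerate triangle are not parallel. -/
theorem eq_of_sides_parallel {q : Fin 3 → ℂ} (hq : AffineIndependent ℝ q) {j j' : Fin 3} {r : ℝ}
    (h : q (j' + 1) - q j' = r * (q (j + 1) - q j)) : j' = j := by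
  have h0 := cross_side_ne_zero hq j
  have hc : cross (q (j + 1) - q j) (q (j' + 1) - q j') = 0 := by
    rw [h, cross_real_mul_right, cross_self, mul_zero]
  rcases fin3_cases j' j with rfl | rfl | rfl
  · rfl
  · exfalso; apply h0
    rw [add_assoc, show (1 + 1 : Fin 3) = 2 from rfl] at hc
    rw [← hc]; simp only [cross, Complex.sub_re, Complex.sub_im]; ring
  · exfalso; apply h0
    rw [add_assoc, show (2 + 1 : Fin 3) = 0 from rfl, add_zero] at hc
    rw [← neg_eq_zero, ← hc]; simp only [cross, Complex.sub_re, Complex.sub_im]; ring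

/-- Near a point of an open side, a positively oriented triangle is the closed half-plane to the
left of this side, and its interior is the open half-plane. -/
theorem eventually_mem_triangle_iff {q : Fin 3 → ℂ} (hq : AffineIndependent ℝ q) {j : Fin 3}
    (ho : 0 < cross (q (j + 1) - q j) (q (j + 2) - q j)) {t : ℝ} (ht : t ∈ Set.Ioo (0 : ℝ) 1) :
    ∀ᶠ w in 𝓝 (sidePoint q j t),
      (w ∈ convexHull ℝ (Set.range q) ↔ 0 ≤ cross (q (j + 1) - q j) (w - sidePoint q j t)) ∧
      (w ∈ interior (convexHull ℝ (Set.range q)) ↔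
        0 < cross (q (j + 1) - q j) (w - sidePoint q j t)) := by
  have hn := fin3_ne j
  have e1 : ∀ᶠ w in 𝓝 (sidePoint q j t), 0 < bary hq j w :=
    (continuous_bary hq j).continuousAt.eventually_const_lt (by
      rw [bary_sidePoint]; simp [hn, ht.2])
  have e2 : ∀ᶠ w in 𝓝 (sidePoint q j t), 0 < bary hq (j + 1) w :=
    (continuous_bary hq _).continuousAt.eventually_const_lt (by
      rw [bary_sidePoint]; simp [hn, ht.1])
  filter_upwards [e1, e2] with w h1 h2
  have hw : cross (q (j + 1) - q j) (w - sidePoint q j t) =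
      bary hq (j + 2) w * cross (q (j + 1) - q j) (q (j + 2) - q j) := by
    rw [← cross_side hq, sidePoint_eq, ← sub_sub, cross_sub_right _ (w - q j),
      cross_real_mul_right, cross_self, mul_zero, sub_zero]
  rw [hw, mem_triangle_iff hq, mem_interior_triangle_iff hq, mul_nonneg_iff_of_pos_right ho,
    mul_pos_iff_of_pos_right ho]
  refine ⟨⟨fun h => h _, fun h k => ?_⟩, ⟨fun h => h _, fun h k => ?_⟩⟩ <;>
    rcases fin3_cases k j with rfl | rfl | rfl <;> first | assumption | exact le_of_lt ‹_›

/-! ### Gluing of the sides -/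

namespace Triangulation

variable {X : Type*} [TopologicalSpace X] {H : HalfDilationStructure X} (T : Triangulation H)

/-- The `i`-th closed Euclidean triangle. -/
abbrev face (i : Fin T.n) : Set ℂ := convexHull ℝ (Set.range (T.corner i))

/-- All Euclidean triangles have their corners in counterclockwise order. -/
def IsOriented : Prop :=
  ∀ i j, 0 < cross (T.corner i (j + 1) - T.corner i j) (T.corner i (j + 2) - T.corner i j)

theorem sing_of_map_notMem {i : Fin T.n} {z : ℂ} (hz : z ∈ T.face i)
    (h : z ∉ Set.range (T.corner i)) : T.map i z ∉ H.sing :=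
  fun hs => h (T.sing_vertex i z hz hs)

/-- In a chart, the parametrization of a triangle is a half-dilation near every point, also near a
boundary point, that is not mapped to a singularity. -/
theorem exists_local_slope {i : Fin T.n} {z : ℂ} (hz : z ∈ T.face i)
    {c : OpenPartialHomeomorph X ℂ} (hc : c ∈ H.charts) (hx : T.map i z ∈ c.source) :
    ∃ a : ℝ, a ≠ 0 ∧ ∀ᶠ w in 𝓝[T.face i] z,
      T.map i w ∈ c.source ∧ c (T.map i w) = c (T.map i z) + a * (w - z) := by
  have hsrc : ∀ᶠ w in 𝓝[T.face i] z, T.map i w ∈ c.source :=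
    (T.continuousOn i z hz).eventually (c.open_source.mem_nhds hx)
  obtain ⟨r, hr, hball⟩ := Metric.mem_nhdsWithin_iff.1 hsrc
  set U := Metric.ball z r ∩ interior (T.face i) with hU
  have hcl : Metric.ball z r ∩ T.face i ⊆ closure U := fun w hw =>
    Metric.isOpen_ball.inter_closure
      ⟨hw.1, triangle_subset_closure_interior (T.nondegenerate i) hw.2⟩
  have hUconv : Convex ℝ U := (convex_ball z r).inter (convex_convexHull ℝ _).interior
  have hUsrc : ∀ w ∈ U, T.map i w ∈ c.source := fun w hw =>
    hball ⟨hw.1, interior_subset hw.2⟩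
  have hne : U.Nonempty := closure_nonempty_iff.1 ⟨z, hcl ⟨Metric.mem_ball_self hr, hz⟩⟩
  obtain ⟨w₀, hw₀⟩ := hne
  obtain ⟨h, ⟨a, b, ha, hab⟩, hh⟩ := T.halfDilation i w₀ hw₀.2 c hc (hUsrc w₀ hw₀)
  have heq : Set.EqOn (fun w => c (T.map i w)) (fun w => (a : ℂ) * w + b) U := by
    refine eqOn_affine_of_locally_affine hUconv.isPreconnected (fun w hw => ?_) hw₀
      (hh.mono fun w hw => hw.trans (hab w))
    obtain ⟨h', ⟨a', b', -, hab'⟩, hh'⟩ := T.halfDilation i w hw.2 c hc (hUsrc w hw)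
    exact ⟨a', b', hh'.mono fun w hw => hw.trans (hab' w)⟩
  have hcont : ContinuousOn (fun w => c (T.map i w)) (Metric.ball z r ∩ T.face i) :=
    c.continuousOn.comp ((T.continuousOn i).mono Set.inter_subset_right) hball
  have heq' : Set.EqOn (fun w => c (T.map i w)) (fun w => (a : ℂ) * w + b)
      (Metric.ball z r ∩ T.face i) :=
    heq.of_subset_closure hcont (by fun_prop)
      (Set.inter_subset_inter_right _ interior_subset) hcl
  refine ⟨a, ha, Metric.mem_nhdsWithin_iff.2 ⟨r, hr, fun w hw => ⟨hball hw, ?_⟩⟩⟩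
  have e1 := heq' hw
  have e2 := heq' ⟨Metric.mem_ball_self hr, hz⟩
  simp only at e1 e2
  rw [e1, e2]; ring

theorem tendsto_add_div (z : ℂ) (a : ℝ) :
    Filter.Tendsto (fun u : ℂ => z + u / a) (𝓝 0) (𝓝 z) := by
  have : Continuous fun u : ℂ => z + u / a := by fun_prop
  simpa using this.tendsto 0

/-- Two different points of the triangles with the same nonsingular image: in a chart, the images of
their neighbourhoods do not overlap. -/
theorem eventually_not_overlap {i j : Fin T.n} {z z' : ℂ} (hne : i = j → z ≠ z')
    (hzz : T.map i z = T.map j z') {c : OpenPartialHomeomorph X ℂ} {a a' : ℝ}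
    (ha : a ≠ 0) (ha' : a' ≠ 0)
    (h : ∀ᶠ w in 𝓝[T.face i] z,
      T.map i w ∈ c.source ∧ c (T.map i w) = c (T.map i z) + a * (w - z))
    (h' : ∀ᶠ w in 𝓝[T.face j] z',
      T.map j w ∈ c.source ∧ c (T.map j w) = c (T.map j z') + a' * (w - z')) :
    ∀ᶠ u : ℂ in 𝓝 0, ¬ (z + u / a ∈ interior (T.face i) ∧ z' + u / a' ∈ interior (T.face j)) := by
  have e1 := (tendsto_add_div z a).eventually (eventually_nhdsWithin_iff.1 h)
  have e2 := (tendsto_add_div z' a').eventually (eventually_nhdsWithin_iff.1 h')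
  have e3 : ∀ᶠ u : ℂ in 𝓝 0, i = j → z + u / a ≠ z' + u / a' := by
    by_cases hij : i = j
    · have := (tendsto_add_div z a).prodMk_nhds (tendsto_add_div z' a')
      have hop : {p : ℂ × ℂ | p.1 ≠ p.2} ∈ 𝓝 (z, z') :=
        (isOpen_ne_fun continuous_fst continuous_snd).mem_nhds (hne hij)
      filter_upwards [this hop] with u hu _ using hu
    · exact Filter.Eventually.of_forall fun u h => absurd h hij
  filter_upwards [e1, e2, e3] with u h1 h2 h3
  rintro ⟨hi, hj⟩
  obtain ⟨s1, c1⟩ := h1 (interior_subset hi)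
  obtain ⟨s2, c2⟩ := h2 (interior_subset hj)
  have hac : (a : ℂ) ≠ 0 := by exact_mod_cast ha
  have hac' : (a' : ℂ) ≠ 0 := by exact_mod_cast ha'
  rw [add_sub_cancel_left, mul_div_cancel₀ _ hac] at c1
  rw [add_sub_cancel_left, mul_div_cancel₀ _ hac', ← hzz] at c2
  have heq : T.map i (z + u / a) = T.map j (z' + u / a') := c.injOn s1 s2 (c1.trans c2.symm)
  by_cases hij : i = j
  · subst hij
    exact h3 rfl (T.injOn i hi hj heq)
  · exact Set.disjoint_left.1 (T.disjoint i j hij) ⟨_, hi, rfl⟩ ⟨_, hj, heq.symm⟩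

/-- If a point has only one preimage in the triangles, then in a chart the image of a neighbourhood
of this preimage is a neighbourhood. -/
theorem eventually_mem_of_unique [T2Space X] {i : Fin T.n} {z : ℂ} (hz : z ∈ T.face i)
    (huniq : ∀ j, ∀ z' ∈ T.face j, T.map j z' = T.map i z → j = i ∧ z' = z)
    {c : OpenPartialHomeomorph X ℂ} (hx : T.map i z ∈ c.source) {a : ℝ} (ha : a ≠ 0)
    (h : ∀ᶠ w in 𝓝[T.face i] z,
      T.map i w ∈ c.source ∧ c (T.map i w) = c (T.map i z) + a * (w - z)) :
    ∀ᶠ u : ℂ in 𝓝 0, z + u / a ∈ T.face i := by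
  obtain ⟨W, hW, hzW, hWf⟩ := mem_nhdsWithin.1 h
  -- points near `T.map i z` have all their preimages in `W`
  have hnear : ∀ᶠ y in 𝓝 (T.map i z), ∀ j, ∀ z' ∈ T.face j, T.map j z' = y → j = i ∧ z' ∈ W := by
    rw [Filter.eventually_all]
    intro j
    have hK : IsCompact (T.face j \ {w | j = i ∧ w ∈ W}) := by
      refine (isCompact_triangle (T.corner j)).diff ?_
      by_cases hj : j = i
      · simpa [hj] using hW
      · simp [hj]
    have hK' := (hK.image_of_continuousOn ((T.continuousOn j).mono Set.sdiff_subset)).isClosed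
    have hmem : T.map i z ∉ T.map j '' (T.face j \ {w | j = i ∧ w ∈ W}) := by
      rintro ⟨w, ⟨hw, hw'⟩, hwz⟩
      obtain ⟨rfl, rfl⟩ := huniq j w hw hwz
      exact hw' ⟨rfl, hzW⟩
    filter_upwards [hK'.isOpen_compl.mem_nhds hmem] with y hy z' hz' hzy
    by_contra hcon
    exact hy ⟨z', ⟨hz', hcon⟩, hzy⟩
  have hct : c (T.map i z) ∈ c.target := c.map_source hx
  have htend : Filter.Tendsto (fun u : ℂ => c.symm (c (T.map i z) + u)) (𝓝 0)
      (𝓝 (T.map i z)) := by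
    have h1 : Filter.Tendsto (fun u : ℂ => c (T.map i z) + u) (𝓝 0) (𝓝 (c (T.map i z))) := by
      have : Continuous fun u : ℂ => c (T.map i z) + u := by fun_prop
      simpa using this.tendsto 0
    have h2 := (c.continuousAt_symm hct).tendsto
    rw [c.left_inv hx] at h2
    exact h2.comp h1
  have htgt : ∀ᶠ u : ℂ in 𝓝 0, c (T.map i z) + u ∈ c.target := by
    have : Continuous fun u : ℂ => c (T.map i z) + u := by fun_prop
    refine this.continuousAt.eventually_mem ?_
    simpa using c.open_target.mem_nhds hct
  filter_upwards [htend.eventually hnear, htgt] with u hu hut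
  obtain ⟨j, z', hz', hzu⟩ := T.cover (c.symm (c (T.map i z) + u))
  obtain ⟨rfl, hzW'⟩ := hu j z' hz' hzu
  obtain ⟨-, hf⟩ := hWf ⟨hzW', hz'⟩
  rw [hzu, c.right_inv hut] at hf
  have hac : (a : ℂ) ≠ 0 := by exact_mod_cast ha
  have : z + u / a = z' := by
    rw [add_left_cancel hf, mul_div_cancel_left₀ _ hac]; ring
  rwa [this]

/-- A point in the interior of a triangle is identified with no other point. -/
theorem interior_unique {i j : Fin T.n} {z z' : ℂ} (hz : z ∈ interior (T.face i))
    (hz' : z' ∈ T.face j) (h : T.map j z' = T.map i z) : j = i ∧ z' = z := by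
  by_contra hcon
  have hsing : T.map i z ∉ H.sing := by
    refine T.sing_of_map_notMem (interior_subset hz) ?_
    rintro ⟨l, rfl⟩
    have h1 := (mem_interior_triangle_iff (T.nondegenerate i)).1 hz (l + 1)
    rw [bary_corner, if_neg (fin3_ne l).1] at h1
    exact lt_irrefl _ h1
  obtain ⟨c, hc, hx⟩ := (H.cover _).2 hsing
  obtain ⟨a, ha, hl⟩ := T.exists_local_slope (interior_subset hz) hc hx
  obtain ⟨a', ha', hl'⟩ := T.exists_local_slope hz' hc (h ▸ hx)
  have hov := T.eventually_not_overlap (fun e1 e2 => hcon ⟨e1.symm, e2.symm⟩) h.symm ha ha' hl hl'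
  have hint := (tendsto_add_div z a).eventually (isOpen_interior.mem_nhds hz)
  have hfr : ∃ᶠ w in 𝓝 z', w ∈ interior (T.face j) :=
    mem_closure_iff_frequently.1 (triangle_subset_closure_interior (T.nondegenerate j) hz')
  have hac' : (a' : ℂ) ≠ 0 := by exact_mod_cast ha'
  have htend : Filter.Tendsto (fun w : ℂ => a' * (w - z')) (𝓝 z') (𝓝 0) := by
    have : Continuous fun w : ℂ => a' * (w - z') := by fun_prop
    simpa using this.tendsto z'
  obtain ⟨w, hw, hn, hi⟩ := (hfr.and_eventually
    (htend.eventually (hov.and hint))).exists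
  refine hn ⟨hi, ?_⟩
  rwa [mul_div_cancel_left₀ _ hac', add_sub_cancel]

/-- A side of a triangle, from a corner to the next one. -/
abbrev Side : Type := Fin T.n × Fin 3

/-- The point with parameter `t` of a side. -/
noncomputable def pt (s : T.Side) (t : ℝ) : ℂ := sidePoint (T.corner s.1) s.2 t

/-- The vector along a side. -/
def dir (s : T.Side) : ℂ := T.corner s.1 (s.2 + 1) - T.corner s.1 s.2

theorem pt_sub (s : T.Side) (t r : ℝ) : T.pt s r - T.pt s t = ((r - t : ℝ) : ℂ) * T.dir s :=
  sidePoint_sub _ _ _ _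

theorem pt_mem (s : T.Side) {t : ℝ} (ht : t ∈ Set.Icc (0 : ℝ) 1) : T.pt s t ∈ T.face s.1 :=
  sidePoint_mem _ _ ht

theorem dir_ne_zero (s : T.Side) : T.dir s ≠ 0 := side_ne_zero (T.nondegenerate s.1) s.2

theorem continuous_pt (s : T.Side) : Continuous (T.pt s) := continuous_sidePoint _ _

theorem map_pt_notMem (s : T.Side) {t : ℝ} (ht : t ∈ Set.Ioo (0 : ℝ) 1) :
    T.map s.1 (T.pt s t) ∉ H.sing :=
  T.sing_of_map_notMem (T.pt_mem s (Set.Ioo_subset_Icc_self ht))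
    (sidePoint_notMem_range (T.nondegenerate s.1) ht)

/-- Near a point of an open side, every small displacement to the left of the side (with respect to
a chart of slope `a`) leads into the open triangle, and only the displacements that are not to the
right lead into the closed triangle. -/
theorem eventually_pt_add_mem (ho : T.IsOriented) (s : T.Side) {t : ℝ}
    (ht : t ∈ Set.Ioo (0 : ℝ) 1) {a : ℝ} (ha : a ≠ 0) :
    ∀ᶠ u : ℂ in 𝓝 0, (0 < cross (a * T.dir s) u → T.pt s t + u / a ∈ interior (T.face s.1)) ∧
      (T.pt s t + u / a ∈ T.face s.1 → 0 ≤ cross (a * T.dir s) u) := by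
  have h := eventually_mem_triangle_iff (T.nondegenerate s.1) (ho s.1 s.2) ht
  filter_upwards [(tendsto_add_div (T.pt s t) a).eventually h] with u hu
  have key : cross (a * T.dir s) u = a ^ 2 *
      cross (T.dir s) (T.pt s t + u / a - sidePoint (T.corner s.1) s.2 t) := by
    have : T.pt s t + u / a - sidePoint (T.corner s.1) s.2 t = ((a⁻¹ : ℝ) : ℂ) * u := by
      rw [pt]; push_cast; ring
    rw [this, cross_real_mul_right, cross_real_mul_left]; field_simp
  have hp : 0 < a ^ 2 := by positivity
  rw [key, mul_pos_iff_of_pos_left hp, mul_nonneg_iff_of_pos_left hp]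
  exact ⟨hu.2.2, hu.1.1⟩

/-- A property of all small vectors holds for some positive multiple of any given vector. -/
theorem exists_pos_mul_of_eventually {P : ℂ → Prop} (h : ∀ᶠ u : ℂ in 𝓝 0, P u) (u : ℂ) :
    ∃ r : ℝ, 0 < r ∧ P (r * u) := by
  have htend : Filter.Tendsto (fun r : ℝ => (r : ℂ) * u) (𝓝[>] 0) (𝓝 0) := by
    have : Continuous fun r : ℝ => (r : ℂ) * u := by fun_prop
    exact (by simpa using this.tendsto 0 :
      Filter.Tendsto (fun r : ℝ => (r : ℂ) * u) (𝓝 0) (𝓝 0)).mono_left nhdsWithin_le_nhds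
  obtain ⟨r, hP, hr⟩ := ((htend.eventually h).and self_mem_nhdsWithin).exists
  exact ⟨r, hr, hP⟩

/-- Two different points of open sides with the same image: the triangles lie on opposite sides. -/
theorem opposite_of_map_eq (ho : T.IsOriented) {s s' : T.Side} {t t' : ℝ}
    (ht : t ∈ Set.Ioo (0 : ℝ) 1) (ht' : t' ∈ Set.Ioo (0 : ℝ) 1) (hne : s = s' → t ≠ t')
    (hzz : T.map s.1 (T.pt s t) = T.map s'.1 (T.pt s' t'))
    {c : OpenPartialHomeomorph X ℂ} {a a' : ℝ} (ha : a ≠ 0) (ha' : a' ≠ 0)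
    (h : ∀ᶠ w in 𝓝[T.face s.1] T.pt s t,
      T.map s.1 w ∈ c.source ∧ c (T.map s.1 w) = c (T.map s.1 (T.pt s t)) + a * (w - T.pt s t))
    (h' : ∀ᶠ w in 𝓝[T.face s'.1] T.pt s' t',
      T.map s'.1 w ∈ c.source ∧
        c (T.map s'.1 w) = c (T.map s'.1 (T.pt s' t')) + a' * (w - T.pt s' t')) :
    ∃ r : ℝ, 0 < r ∧ a' * T.dir s' = -(r * (a * T.dir s)) := by
  have hne' : s.1 = s'.1 → T.pt s t ≠ T.pt s' t' := by
    obtain ⟨i, j⟩ := s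
    obtain ⟨i', j'⟩ := s'
    rintro h1 h2
    simp only at h1
    subst h1
    obtain ⟨rfl, rfl⟩ := sidePoint_injective (T.nondegenerate i) ht ht' h2
    exact hne rfl rfl
  have hev := (T.eventually_not_overlap hne' hzz ha ha' h h').and
    ((T.eventually_pt_add_mem ho s ht ha).and (T.eventually_pt_add_mem ho s' ht' ha'))
  have hac : (a : ℂ) ≠ 0 := by exact_mod_cast ha
  have hac' : (a' : ℂ) ≠ 0 := by exact_mod_cast ha'
  refine exists_neg_mul_of_disjoint_halfPlanes (mul_ne_zero hac (T.dir_ne_zero s))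
    (mul_ne_zero hac' (T.dir_ne_zero s')) fun u => ?_
  rintro ⟨h1, h2⟩
  obtain ⟨r, hr, hn, p1, p2⟩ := exists_pos_mul_of_eventually hev u
  refine hn ⟨p1.1 ?_, p2.1 ?_⟩
  · rw [cross_real_mul_right]; exact mul_pos hr h1
  · rw [cross_real_mul_right]; exact mul_pos hr h2

/-- Every point of an open side is identified with exactly one other point, which also lies on an
open side. -/
theorem existsUnique_partner [T2Space X] (ho : T.IsOriented) (s : T.Side) {t : ℝ}
    (ht : t ∈ Set.Ioo (0 : ℝ) 1) :
    ∃! p : T.Side × ℝ, p.2 ∈ Set.Ioo (0 : ℝ) 1 ∧ p ≠ (s, t) ∧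
      T.map p.1.1 (T.pt p.1 p.2) = T.map s.1 (T.pt s t) := by
  have hz := T.pt_mem s (Set.Ioo_subset_Icc_self ht)
  obtain ⟨c, hc, hx⟩ := (H.cover _).2 (T.map_pt_notMem s ht)
  obtain ⟨a, ha, hl⟩ := T.exists_local_slope hz hc hx
  have hac : (a : ℂ) ≠ 0 := by exact_mod_cast ha
  have hD : (a : ℂ) * T.dir s ≠ 0 := mul_ne_zero hac (T.dir_ne_zero s)
  refine existsUnique_of_exists_of_unique ?_ ?_
  · by_contra hcon
    push Not at hcon
    have huniq : ∀ j, ∀ z' ∈ T.face j, T.map j z' = T.map s.1 (T.pt s t) →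
        j = s.1 ∧ z' = T.pt s t := by
      intro j z' hz' hzz
      rcases triangle_cases (T.nondegenerate j) hz' with hi | ⟨k, rfl⟩ | ⟨k, t', ht', rfl⟩
      · exact (T.interior_unique hi hz hzz.symm).imp Eq.symm Eq.symm
      · exact absurd (hzz ▸ T.vertex_mem j k) (T.map_pt_notMem s ht)
      · by_contra hne
        refine hcon ((j, k), t') ht' ?_ hzz
        rintro ⟨⟩
        exact hne ⟨rfl, rfl⟩
    have hev := (T.eventually_mem_of_unique hz huniq hx ha hl).and
      (T.eventually_pt_add_mem ho s ht ha)
    obtain ⟨r, hr, hm, -, hm'⟩ := exists_pos_mul_of_eventually hev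
      (-(Complex.I * (a * T.dir s)))
    have h0 := hm' hm
    have h1 := cross_I_mul_pos hD
    rw [cross_real_mul_right, ← zero_sub, cross_sub_right, mul_nonneg_iff_of_pos_left hr] at h0
    simp only [cross, Complex.zero_re, Complex.zero_im, mul_zero, sub_zero, zero_sub] at h0 h1
    linarith
  · rintro ⟨s₁, t₁⟩ ⟨s₂, t₂⟩ ⟨ht₁, hne₁, h₁⟩ ⟨ht₂, hne₂, h₂⟩
    by_contra hne
    obtain ⟨a₁, ha₁, hl₁⟩ := T.exists_local_slope (T.pt_mem s₁ (Set.Ioo_subset_Icc_self ht₁)) hc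
      (h₁ ▸ hx)
    obtain ⟨a₂, ha₂, hl₂⟩ := T.exists_local_slope (T.pt_mem s₂ (Set.Ioo_subset_Icc_self ht₂)) hc
      (h₂ ▸ hx)
    obtain ⟨r₁, hr₁, e₁⟩ := T.opposite_of_map_eq ho ht ht₁
      (fun e1 e2 => hne₁ (Prod.ext e1.symm e2.symm)) h₁.symm ha ha₁ hl hl₁
    obtain ⟨r₂, hr₂, e₂⟩ := T.opposite_of_map_eq ho ht ht₂
      (fun e1 e2 => hne₂ (Prod.ext e1.symm e2.symm)) h₂.symm ha ha₂ hl hl₂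
    obtain ⟨r, hr, e⟩ := T.opposite_of_map_eq ho ht₁ ht₂
      (fun e1 e2 => hne (Prod.ext e1 e2)) (h₁.trans h₂.symm) ha₁ ha₂ hl₁ hl₂
    -- three half-planes with a common boundary point cannot be opposite pairwise
    rw [e₁, e₂] at e
    have h0 : ((r₂ + r * r₁ : ℝ) : ℂ) * (a * T.dir s) = 0 := by
      push_cast; linear_combination -e
    rcases mul_eq_zero.1 h0 with h0 | h0
    · have : 0 < r₂ + r * r₁ := by positivity
      exact this.ne' (by exact_mod_cast h0)
    · exact hD h0

end Triangulation

/-- A map from the open unit interval to a disjoint union of lines, decreasing and affine near every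
point, is affine with values in one line. -/
theorem exists_affine_of_locally_affine {S : Type*} {f : ℝ → S × ℝ}
    (hf : ∀ t ∈ Set.Ioo (0 : ℝ) 1, ∃ k : ℝ, 0 < k ∧
      ∀ᶠ r in 𝓝 t, f r = ((f t).1, (f t).2 - k * (r - t))) :
    ∃ (s : S) (b k : ℝ), 0 < k ∧ ∀ t ∈ Set.Ioo (0 : ℝ) 1, f t = (s, b - k * t) := by
  have hpre : IsPreconnected (Set.Ioo (0 : ℝ) 1) := isPreconnected_Ioo
  have hmem : (1 / 2 : ℝ) ∈ Set.Ioo (0 : ℝ) 1 := by norm_num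
  obtain ⟨k, hk, hev⟩ := hf _ hmem
  refine ⟨(f (1 / 2)).1, (f (1 / 2)).2 + k * (1 / 2), k, hk, fun t ht => Prod.ext ?_ ?_⟩
  · let _ : TopologicalSpace S := ⊥
    have : DiscreteTopology S := ⟨rfl⟩
    have hc : ContinuousOn (fun r => (f r).1) (Set.Ioo (0 : ℝ) 1) := by
      intro t ht
      obtain ⟨k, -, h⟩ := hf t ht
      exact (continuousAt_const.congr (f := fun _ => (f t).1)
        (h.mono fun r hr => by simp [hr])).continuousWithinAt
    exact hpre.constant_of_mapsTo (T := Set.univ) ⟨inferInstance⟩ hc (fun _ _ => trivial) ht hmem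
  · have := eqOn_affine_of_locally_affine (𝕜 := ℝ) hpre (f := fun r => (f r).2)
      (fun z hz => by
        obtain ⟨k, -, h⟩ := hf z hz
        exact ⟨-k, (f z).2 + k * z, h.mono fun r hr => by simp only [hr]; ring⟩)
      hmem (a := -k) (b := (f (1 / 2)).2 + k * (1 / 2))
      (hev.mono fun r hr => by simp only [hr]; ring) t ht
    simp only at this ⊢
    rw [this]; ring

/-- Two decreasing affine maps of the open unit interval to itself that are inverse to each other
are the flip of the interval. -/
theorem affine_involution_eq {b k b' k' : ℝ} (hk : 0 < k)
    (h : ∀ t ∈ Set.Ioo (0 : ℝ) 1, b - k * t ∈ Set.Ioo (0 : ℝ) 1)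
    (h' : ∀ t ∈ Set.Ioo (0 : ℝ) 1, b' - k' * t ∈ Set.Ioo (0 : ℝ) 1)
    (hinv : ∀ t ∈ Set.Ioo (0 : ℝ) 1, b' - k' * (b - k * t) = t) : b = 1 ∧ k = 1 := by
  have hbound : ∀ b k : ℝ, (∀ t ∈ Set.Ioo (0 : ℝ) 1, b - k * t ∈ Set.Ioo (0 : ℝ) 1) →
      ∀ t ∈ Set.Icc (0 : ℝ) 1, b - k * t ∈ Set.Icc (0 : ℝ) 1 := by
    intro b k hb
    have hc : Continuous fun t : ℝ => b - k * t := by fun_prop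
    have hm : Set.MapsTo (fun t : ℝ => b - k * t) (Set.Ioo 0 1) (Set.Icc 0 1) :=
      fun t ht => Set.Ioo_subset_Icc_self (hb t ht)
    have := hm.closure_of_continuousOn hc.continuousOn
    rwa [closure_Ioo zero_ne_one, isClosed_Icc.closure_eq] at this
  have a0 := hbound b k h 0 (by simp)
  have a1 := hbound b k h 1 (by simp)
  have a2 := hbound b' k' h' 0 (by simp)
  have a3 := hbound b' k' h' 1 (by simp)
  have i1 := hinv (1 / 2) (by norm_num)
  have i2 := hinv (1 / 4) (by norm_num)
  have hkk : k' * k = 1 := by linarith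
  simp only [Set.mem_Icc, mul_zero, sub_zero, mul_one] at a0 a1 a2 a3
  have hk1 : k = 1 := by nlinarith
  exact ⟨by linarith, hk1⟩

namespace Triangulation

variable {X : Type*} [TopologicalSpace X] {H : HalfDilationStructure X} (T : Triangulation H)

/-- Near two identified points of open sides, the sides are parallel and identified by a decreasing
affine map of the parameters. -/
theorem exists_local_partner (ho : T.IsOriented) {s s' : T.Side} {t t' : ℝ}
    (ht : t ∈ Set.Ioo (0 : ℝ) 1) (ht' : t' ∈ Set.Ioo (0 : ℝ) 1) (hne : s = s' → t ≠ t')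
    (hzz : T.map s.1 (T.pt s t) = T.map s'.1 (T.pt s' t')) :
    (∃ l : ℝ, T.dir s' = l * T.dir s) ∧
    ∃ k : ℝ, 0 < k ∧ ∀ᶠ r in 𝓝 t,
      T.map s'.1 (T.pt s' (t' - k * (r - t))) = T.map s.1 (T.pt s r) := by
  have hz := T.pt_mem s (Set.Ioo_subset_Icc_self ht)
  have hz' := T.pt_mem s' (Set.Ioo_subset_Icc_self ht')
  obtain ⟨c, hc, hx⟩ := (H.cover _).2 (T.map_pt_notMem s ht)
  obtain ⟨a, ha, hl⟩ := T.exists_local_slope hz hc hx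
  obtain ⟨a', ha', hl'⟩ := T.exists_local_slope hz' hc (hzz ▸ hx)
  obtain ⟨r₀, hr₀, hpar⟩ := T.opposite_of_map_eq ho ht ht' hne hzz ha ha' hl hl'
  have hac' : (a' : ℂ) ≠ 0 := by exact_mod_cast ha'
  have hrc : (r₀ : ℂ) ≠ 0 := by exact_mod_cast hr₀.ne'
  refine ⟨⟨-(r₀ * a) / a', ?_⟩, r₀⁻¹, inv_pos.2 hr₀, ?_⟩
  · push_cast
    field_simp
    linear_combination hpar
  have htend : ∀ (s : T.Side) {t : ℝ} {f : ℝ → ℝ} {x : ℝ}, Continuous f → f x = t →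
      t ∈ Set.Ioo (0 : ℝ) 1 →
      Filter.Tendsto (fun r => T.pt s (f r)) (𝓝 x) (𝓝[T.face s.1] T.pt s t) := by
    intro s t f x hf hfx ht
    subst hfx
    refine tendsto_nhdsWithin_iff.2 ⟨((T.continuous_pt s).comp hf).tendsto x, ?_⟩
    filter_upwards [hf.continuousAt.eventually_mem (isOpen_Ioo.mem_nhds ht)] with r hr
    exact T.pt_mem s (Set.Ioo_subset_Icc_self hr)
  have h1 := (htend s continuous_id rfl ht).eventually hl
  have h2 := (htend s' (f := fun r => t' - r₀⁻¹ * (r - t)) (x := t) (by fun_prop) (by ring)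
    ht').eventually hl'
  filter_upwards [h1, h2] with r ⟨e1, e2⟩ ⟨e3, e4⟩
  refine c.injOn e3 e1 ?_
  simp only [id] at e2
  rw [e4, e2, ← hzz, T.pt_sub, T.pt_sub]
  push_cast
  have : (a' : ℂ) * ((t' - (r₀ : ℂ)⁻¹ * (r - t) - t') * T.dir s') =
      -((r₀ : ℂ)⁻¹ * (r - t)) * (a' * T.dir s') := by ring
  rw [this, hpar]
  field_simp

/-- The involution `τ` of the sides is the pairing by which the sides are glued. -/
structure IsGluing (τ : T.Side → T.Side) : Prop where
  /-- the pairing is an involution -/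
  involutive : ∀ s, τ (τ s) = s
  /-- glued sides have the same image, with the direction reversed -/
  map_eq : ∀ s, ∀ t ∈ Set.Icc (0 : ℝ) 1, T.map (τ s).1 (T.pt (τ s) (1 - t)) = T.map s.1 (T.pt s t)
  /-- points of open sides are identified only by the gluing -/
  eq_or_eq : ∀ s s', ∀ t ∈ Set.Ioo (0 : ℝ) 1, ∀ t' ∈ Set.Ioo (0 : ℝ) 1,
    T.map s'.1 (T.pt s' t') = T.map s.1 (T.pt s t) → (s' = s ∧ t' = t) ∨ (s' = τ s ∧ t' = 1 - t)
  /-- two sides of the same triangle are not glued to each other -/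
  face_ne : ∀ s, (τ s).1 ≠ s.1

theorem exists_isGluing [T2Space X] (ho : T.IsOriented) : ∃ τ, T.IsGluing τ := by
  have hex := fun (s : T.Side) (t : ℝ) (ht : t ∈ Set.Ioo (0 : ℝ) 1) =>
    (T.existsUnique_partner ho s ht).exists
  have hun := fun (s : T.Side) (t : ℝ) (ht : t ∈ Set.Ioo (0 : ℝ) 1) {p q : T.Side × ℝ} =>
    (T.existsUnique_partner ho s ht).unique (y₁ := p) (y₂ := q)
  choose! P hP using hex
  have hPne : ∀ s t, t ∈ Set.Ioo (0 : ℝ) 1 → s = (P s t).1 → t ≠ (P s t).2 :=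
    fun s t ht e1 e2 => (hP s t ht).2.1 (Prod.ext e1.symm e2.symm)
  have hloc : ∀ s t, t ∈ Set.Ioo (0 : ℝ) 1 → ∃ k : ℝ, 0 < k ∧
      ∀ᶠ r in 𝓝 t, P s r = ((P s t).1, (P s t).2 - k * (r - t)) := by
    intro s t ht
    obtain ⟨ht', -, hm⟩ := hP s t ht
    obtain ⟨-, k, hk, hev⟩ := T.exists_local_partner ho ht ht' (hPne s t ht) hm.symm
    refine ⟨k, hk, ?_⟩
    have hc : ContinuousAt (fun r => (P s t).2 - k * (r - t)) t := by fun_prop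
    have hv : (P s t).2 - k * (t - t) = (P s t).2 := by ring
    have e1 : ∀ᶠ r in 𝓝 t, r ∈ Set.Ioo (0 : ℝ) 1 := isOpen_Ioo.mem_nhds ht
    have e2 : ∀ᶠ r in 𝓝 t, (P s t).2 - k * (r - t) ∈ Set.Ioo (0 : ℝ) 1 :=
      hc.eventually_mem (isOpen_Ioo.mem_nhds (by rwa [hv]))
    have e3 : ∀ᶠ r in 𝓝 t, s = (P s t).1 → r ≠ (P s t).2 - k * (r - t) := by
      by_cases h : s = (P s t).1
      · have hop := (continuousAt_id.prodMk hc).eventually_mem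
          ((isOpen_ne_fun continuous_fst continuous_snd).mem_nhds
            (x := (t, (P s t).2 - k * (t - t))) (by rw [hv]; exact hPne s t ht h))
        filter_upwards [hop] with r hr _ using hr
      · exact Filter.Eventually.of_forall fun r h' => absurd h' h
    filter_upwards [hev, e1, e2, e3] with r h1 h2 h3 h4
    refine hun s r h2 (hP s r h2) ⟨h3, fun he => ?_, h1⟩
    rw [Prod.mk.injEq] at he
    exact h4 he.1.symm he.2.symm
  choose τ b k hk hτ using fun s => exists_affine_of_locally_affine (hloc s)
  have hPP : ∀ s t, t ∈ Set.Ioo (0 : ℝ) 1 → P (P s t).1 (P s t).2 = (s, t) := by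
    intro s t ht
    obtain ⟨h1, h2, h3⟩ := hP s t ht
    refine hun _ _ h1 (hP _ _ h1) ⟨ht, fun he => h2 ?_, h3.symm⟩
    rw [Prod.mk.injEq] at he
    exact Prod.ext he.1.symm he.2.symm
  have hmem : ∀ s, ∀ t ∈ Set.Ioo (0 : ℝ) 1, b s - k s * t ∈ Set.Ioo (0 : ℝ) 1 := by
    intro s t ht
    have := (hP s t ht).1
    rwa [hτ s t ht] at this
  have hinv : ∀ s, ∀ t ∈ Set.Ioo (0 : ℝ) 1,
      (τ (τ s), b (τ s) - k (τ s) * (b s - k s * t)) = (s, t) := by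
    intro s t ht
    have := hPP s t ht
    rw [hτ s t ht] at this
    rw [← this]
    exact (hτ (τ s) _ (hmem s t ht)).symm
  have hflip : ∀ s, ∀ t ∈ Set.Ioo (0 : ℝ) 1, P s t = (τ s, 1 - t) := by
    intro s t ht
    obtain ⟨e1, e2⟩ := affine_involution_eq (hk s) (hmem s) (hmem (τ s))
      fun t ht => congrArg Prod.snd (hinv s t ht)
    rw [hτ s t ht, e1, e2, one_mul]
  have hhalf : (1 / 2 : ℝ) ∈ Set.Ioo (0 : ℝ) 1 := by norm_num
  have hττ : ∀ s, τ (τ s) = s := fun s => congrArg Prod.fst (hinv s _ hhalf)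
  have hne : ∀ s, τ s ≠ s := by
    intro s hs
    have := (hP s _ hhalf).2.1
    rw [hflip s _ hhalf, hs] at this
    norm_num at this
  refine ⟨τ, hττ, fun s => ?_, fun s s' t ht t' ht' h => ?_, fun s hs => ?_⟩
  · -- the identification extends to the endpoints of the sides by continuity
    have heq : Set.EqOn (fun t : ℝ => T.map (τ s).1 (T.pt (τ s) (1 - t)))
        (fun t => T.map s.1 (T.pt s t)) (Set.Ioo 0 1) := by
      intro t ht
      have := (hP s t ht).2.2
      rwa [hflip s t ht] at this
    have c1 : ContinuousOn (fun t : ℝ => T.map (τ s).1 (T.pt (τ s) (1 - t))) (Set.Icc 0 1) :=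
      (T.continuousOn _).comp
        ((T.continuous_pt (τ s)).comp (continuous_const.sub continuous_id)).continuousOn
        fun t ht => T.pt_mem _ ⟨by linarith [ht.2], by linarith [ht.1]⟩
    have c2 : ContinuousOn (fun t : ℝ => T.map s.1 (T.pt s t)) (Set.Icc 0 1) :=
      (T.continuousOn _).comp (T.continuous_pt s).continuousOn fun t ht => T.pt_mem _ ht
    exact fun t ht => heq.of_subset_closure c1 c2 Set.Ioo_subset_Icc_self
      (closure_Ioo zero_ne_one).ge ht
  · by_cases hst : (s', t') = (s, t)
    · exact Or.inl (Prod.mk.injEq _ _ _ _ ▸ hst)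
    · right
      have := hun s t ht (p := (s', t')) ⟨ht', hst, h⟩ (hP s t ht)
      rw [hflip s t ht] at this
      exact Prod.mk.injEq _ _ _ _ ▸ this
  · -- glued sides are parallel, but the sides of one triangle are not
    obtain ⟨ht', -, hm⟩ := hP s _ hhalf
    obtain ⟨⟨l, hl⟩, -⟩ := T.exists_local_partner ho hhalf ht' (hPne s _ hhalf) hm.symm
    rw [hflip s _ hhalf] at hl
    simp only at hl
    refine hne s (Prod.ext hs ?_)
    rw [dir, dir, hs] at hl
    exact eq_of_sides_parallel (T.nondegenerate s.1) hl

end Triangulation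

/-! ### Euler's formula -/

/-- The side that follows a side on the boundary of its triangle. -/
def next {F : Type*} (s : F × Fin 3) : F × Fin 3 := (s.1, s.2 + 1)

/-- A connected surface glued from triangles with the set `F` of triangles and the set `V` of
vertices, as combinatorial data. The side `(f, j)` runs from the corner `j` of the triangle `f` to
the corner `j + 1`; the side `s` is glued to `pair s` with the direction reversed, and `vertex s` is
the vertex at which `s` starts. Two sides of one triangle are never glued to each other. -/
structure TriangleGluing (F V : Type*) where
  /-- the pairing of the sides -/
  pair : F × Fin 3 → F × Fin 3
  /-- the vertex at which a side starts -/
  vertex : F × Fin 3 → V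
  pair_pair : ∀ s, pair (pair s) = s
  face_ne : ∀ s, (pair s).1 ≠ s.1
  vertex_pair : ∀ s, vertex (pair s) = vertex (next s)
  vertex_surjective : Function.Surjective vertex
  connected : ∀ S : Set F, S.Nonempty → (∀ s : F × Fin 3, s.1 ∈ S → (pair s).1 ∈ S) → S = Set.univ

namespace TriangleGluing

variable {F V : Type*} (G : TriangleGluing F V)

theorem pair_ne (s : F × Fin 3) : G.pair s ≠ s := fun h => G.face_ne s (congrArg Prod.fst h)

theorem vertex_next_pair (s : F × Fin 3) : G.vertex (next (G.pair s)) = G.vertex s := by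
  rw [← G.vertex_pair, G.pair_pair]

/-- The rational cellular `1`-cochains: functions of the directed sides that change sign with the
direction. -/
def cochains : Submodule ℚ (F × Fin 3 → ℚ) where
  carrier := {c | ∀ s, c (G.pair s) = -c s}
  add_mem' := by
    intro a b ha hb s
    simp only [Pi.add_apply, ha s, hb s, neg_add]
  zero_mem' := by intro s; simp
  smul_mem' := by
    intro r a ha s
    simp only [Pi.smul_apply, ha s, smul_neg]

/-- The coboundary of a function of the vertices. -/
def d0 : (V → ℚ) →ₗ[ℚ] G.cochains where
  toFun p := ⟨fun s => p (G.vertex (next s)) - p (G.vertex s), fun s => by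
    simp only [G.vertex_pair, G.vertex_next_pair, neg_sub]⟩
  map_add' p q := by ext s; simp; ring
  map_smul' r p := by ext s; simp; ring

/-- The coboundary of a `1`-cochain. -/
def d1 : G.cochains →ₗ[ℚ] (F → ℚ) where
  toFun c f := ∑ j, c.1 (f, j)
  map_add' c c' := by ext f; simp [Finset.sum_add_distrib]
  map_smul' r c := by ext f; simp [Finset.mul_sum]

/-- On a connected surface, the functions of the vertices with zero coboundary are the constants. -/
theorem finrank_ker_d0 [Nonempty F] : Module.finrank ℚ (LinearMap.ker G.d0) = 1 := by
  obtain ⟨f₀⟩ := ‹Nonempty F›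
  have hker : LinearMap.ker G.d0 = Submodule.span ℚ {fun _ : V => (1 : ℚ)} := by
    ext p
    rw [LinearMap.mem_ker, Submodule.mem_span_singleton]
    constructor
    · intro hp
      have hs : ∀ s, p (G.vertex (next s)) = p (G.vertex s) := fun s => by
        have := congrFun (congrArg Subtype.val hp) s
        exact sub_eq_zero.1 this
      have hface : ∀ f j, p (G.vertex (f, j)) = p (G.vertex (f, 0)) := by
        intro f j
        have h1 := hs (f, 0)
        have h2 := hs (f, 1)
        simp only [next] at h1 h2
        fin_cases j
        · rfl
        · exact h1
        · exact h2.trans h1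
      have huniv := G.connected {f | p (G.vertex (f, 0)) = p (G.vertex (f₀, 0))} ⟨f₀, rfl⟩ (by
        intro s hs'
        have h1 := G.vertex_pair s
        have h2 := hface (G.pair s).1 (G.pair s).2
        have h3 := hface s.1 s.2
        have h4 := hs s
        simp only [Set.mem_ofPred_eq, Prod.mk.eta] at *
        rw [← h2, h1, h4, h3, hs'])
      refine ⟨p (G.vertex (f₀, 0)), ?_⟩
      ext v
      obtain ⟨⟨f, j⟩, rfl⟩ := G.vertex_surjective v
      have hf : f ∈ {f | p (G.vertex (f, 0)) = p (G.vertex (f₀, 0))} := huniv ▸ Set.mem_univ f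
      simp only [Pi.smul_apply, smul_eq_mul, mul_one]
      rw [hface f j]
      exact Eq.symm hf
    · rintro ⟨r, rfl⟩
      apply Subtype.ext
      ext s
      simp [d0]
  rw [hker, finrank_span_singleton]
  intro h
  simpa using congrFun h (G.vertex (f₀, 0))

variable [Fintype F]

/-- The dimension of the space of cochains is the number of edges, half the number of sides. -/
theorem two_mul_finrank_cochains : 2 * Module.finrank ℚ G.cochains = 3 * Fintype.card F := by
  classical
  -- the side that comes first in some linear order represents its glued pair of sides
  let e := Fintype.equivFin (F × Fin 3)
  let A := {s : F × Fin 3 // e s < e (G.pair s)}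
  have hnot : ∀ s, ¬ e s < e (G.pair s) → e (G.pair s) < e (G.pair (G.pair s)) := by
    intro s hs
    rw [G.pair_pair]
    exact lt_of_le_of_ne (not_lt.1 hs) fun h => G.pair_ne s (e.injective h)
  let E : G.cochains ≃ₗ[ℚ] (A → ℚ) :=
    { toFun := fun c a => c.1 a.1
      map_add' := fun _ _ => rfl
      map_smul' := fun _ _ => rfl
      invFun := fun f => ⟨fun s => if h : e s < e (G.pair s) then f ⟨s, h⟩
          else -f ⟨G.pair s, hnot s h⟩, fun s => by
        by_cases h : e s < e (G.pair s)
        · have h' : ¬ e (G.pair s) < e (G.pair (G.pair s)) := by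
            rw [G.pair_pair]; exact not_lt.2 h.le
          have hp : (⟨G.pair (G.pair s), hnot _ h'⟩ : A) = ⟨s, h⟩ := Subtype.ext (G.pair_pair s)
          simp only [dif_pos h]
          rw [dif_neg h', hp]
        · simp only [dif_neg h, dif_pos (hnot s h), neg_neg]⟩
      left_inv := fun c => by
        apply Subtype.ext
        ext s
        by_cases h : e s < e (G.pair s)
        · simp only [dif_pos h]
        · simp only [dif_neg h, c.2 s, neg_neg]
      right_inv := fun f => by
        ext a
        exact dif_pos a.2 }
  have hcard : Fintype.card A = Fintype.card {s : F × Fin 3 // ¬ e s < e (G.pair s)} := by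
    refine Fintype.card_congr
      { toFun := fun a => ⟨G.pair a.1, by rw [G.pair_pair]; exact not_lt.2 a.2.le⟩
        invFun := fun a => ⟨G.pair a.1, hnot a.1 a.2⟩
        left_inv := fun a => Subtype.ext (G.pair_pair _)
        right_inv := fun a => Subtype.ext (G.pair_pair _) }
  have hsum := Fintype.card_subtype_compl (fun s : F × Fin 3 => e s < e (G.pair s))
  have hle := Fintype.card_subtype_le (fun s : F × Fin 3 => e s < e (G.pair s))
  have hprod : Fintype.card (F × Fin 3) = Fintype.card F * 3 := by simp
  rw [E.finrank_eq, Module.finrank_fintype_fun_eq_card]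
  change Fintype.card A = _ at hcard
  change _ = _ - Fintype.card A at hsum
  change Fintype.card A ≤ _ at hle
  omega

/-- The coboundaries are the functions of the triangles with sum zero: the sum vanishes because
the sides cancel in pairs, and the converse holds because the surface is connected. -/
theorem finrank_range_d1 [Nonempty F] :
    Module.finrank ℚ (LinearMap.range G.d1) + 1 = Fintype.card F := by
  classical
  let S : (F → ℚ) →ₗ[ℚ] ℚ := ∑ f, LinearMap.proj f
  have hS : ∀ x : F → ℚ, S x = ∑ f, x f := fun x => by simp [S]
  obtain ⟨f₀⟩ := ‹Nonempty F›
  -- differences of triangles across a side are coboundaries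
  have hadj : ∀ s : F × Fin 3,
      (Pi.single s.1 1 - Pi.single (G.pair s).1 1 : F → ℚ) ∈ LinearMap.range G.d1 := by
    intro s
    refine ⟨⟨Pi.single s 1 - Pi.single (G.pair s) 1, fun t => ?_⟩, ?_⟩
    · have h1 : G.pair t = s ↔ t = G.pair s :=
        ⟨fun h => by rw [← h, G.pair_pair], fun h => by rw [h, G.pair_pair]⟩
      have h2 : G.pair t = G.pair s ↔ t = s :=
        ⟨fun h => by rw [← G.pair_pair t, h, G.pair_pair], fun h => by rw [h]⟩
      simp only [Pi.sub_apply, Pi.single_apply, h1, h2, neg_sub]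
    · have hsum : ∀ (u : F × Fin 3) (f : F),
          ∑ j, (Pi.single u 1 : F × Fin 3 → ℚ) (f, j) = (Pi.single u.1 1 : F → ℚ) f := by
        intro u f
        by_cases hf : f = u.1
        · subst hf
          simp [Pi.single_apply, Prod.ext_iff]
        · simp [Prod.ext_iff, hf]
      ext f
      simp only [d1, LinearMap.coe_mk, AddHom.coe_mk, Pi.sub_apply, Finset.sum_sub_distrib, hsum]
  have hall : ∀ f, (Pi.single f 1 - Pi.single f₀ 1 : F → ℚ) ∈ LinearMap.range G.d1 := by
    have := G.connected {f | (Pi.single f 1 - Pi.single f₀ 1 : F → ℚ) ∈ LinearMap.range G.d1}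
      ⟨f₀, by rw [Set.mem_ofPred_eq, sub_self]; exact Submodule.zero_mem _⟩ (by
        intro s hs
        have h := Submodule.sub_mem _ hs (hadj s)
        rwa [sub_sub_sub_cancel_left] at h)
    exact fun f => (this ▸ Set.mem_univ f :)
  have hrange : LinearMap.range G.d1 = LinearMap.ker S := by
    apply le_antisymm
    · rintro _ ⟨c, rfl⟩
      rw [LinearMap.mem_ker, hS]
      have h1 : ∑ f, G.d1 c f = ∑ s, c.1 s := by
        rw [Fintype.sum_prod_type]; rfl
      have h2 : ∑ s, c.1 s = -∑ s, c.1 s := by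
        rw [← Finset.sum_neg_distrib, ← Equiv.sum_comp
          (⟨G.pair, G.pair, G.pair_pair, G.pair_pair⟩ : F × Fin 3 ≃ F × Fin 3)]
        exact Finset.sum_congr rfl fun s _ => c.2 s
      rw [h1]; linarith
    · intro x hx
      rw [LinearMap.mem_ker, hS] at hx
      have : x = ∑ f, x f • (Pi.single f 1 - Pi.single f₀ 1 : F → ℚ) := by
        simp only [smul_sub, Finset.sum_sub_distrib, ← Finset.sum_smul, hx, zero_smul, sub_zero]
        ext g
        simp [Pi.single_apply]
      rw [this]
      exact Submodule.sum_mem _ fun f _ => Submodule.smul_mem _ _ (hall f)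
  have hsurj : LinearMap.range S = ⊤ :=
    LinearMap.range_eq_top.2 fun r => ⟨Pi.single f₀ r, by rw [hS]; simp⟩
  have := S.finrank_range_add_finrank_ker
  rw [hsurj, finrank_top, Module.finrank_self, Module.finrank_fintype_fun_eq_card] at this
  rw [hrange]; omega

/-- If every integral `1`-cocycle is a coboundary, the surface satisfies Euler's formula for the
sphere. As there are `3 / 2` times as many edges as triangles, it takes the stated form. -/
theorem card_faces [Fintype V] [Nonempty F]
    (hexact : ∀ c : F × Fin 3 → ℤ, (∀ s, c (G.pair s) = -c s) → (∀ f, ∑ j, c (f, j) = 0) →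
      ∃ p : V → ℤ, ∀ s, c s = p (G.vertex (next s)) - p (G.vertex s)) :
    Fintype.card F + 4 = 2 * Fintype.card V := by
  have hker : LinearMap.ker G.d1 = LinearMap.range G.d0 := by
    apply le_antisymm
    · rintro ⟨c, hc⟩ hd
      -- clear denominators
      obtain ⟨N, hN⟩ := IsLocalization.exist_integer_multiples_of_finite
        (nonZeroDivisors ℤ) c
      choose m hm using hN
      have hN0 : (N : ℤ) ≠ 0 := nonZeroDivisors.ne_zero N.2
      have hNQ : ((N : ℤ) : ℚ) ≠ 0 := by exact_mod_cast hN0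
      have hm' : ∀ s, (m s : ℚ) = (N : ℤ) * c s := fun s => by
        have := hm s
        simpa [zsmul_eq_mul] using this
      obtain ⟨p, hp⟩ := hexact m
        (fun s => by
          have : (m (G.pair s) : ℚ) = -m s := by rw [hm', hm', hc s]; ring
          exact_mod_cast this)
        (fun f => by
          have h1 : ∑ j, c (f, j) = 0 := congrFun hd f
          have : ∑ j, (m (f, j) : ℚ) = 0 := by
            simp only [hm', ← Finset.mul_sum, h1, mul_zero]
          exact_mod_cast this)
      refine ⟨fun v => (p v : ℚ) / (N : ℤ), Subtype.ext (funext fun s => ?_)⟩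
      have h2 : (m s : ℚ) = p (G.vertex (next s)) - p (G.vertex s) := by exact_mod_cast hp s
      rw [hm'] at h2
      simp only [d0, LinearMap.coe_mk, AddHom.coe_mk]
      rw [← sub_div, ← h2, mul_div_cancel_left₀ _ hNQ]
    · rintro _ ⟨p, rfl⟩
      rw [LinearMap.mem_ker]
      ext f
      simp [d1, d0, next, Fin.sum_univ_three]
  have h0 := G.d0.finrank_range_add_finrank_ker
  have h1 := G.d1.finrank_range_add_finrank_ker
  have h2 := G.two_mul_finrank_cochains
  have h3 := G.finrank_range_d1
  rw [G.finrank_ker_d0, Module.finrank_fintype_fun_eq_card] at h0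
  rw [hker] at h1
  omega

end TriangleGluing

/-! ### The gluing of a triangulation of the sphere -/

namespace Triangulation

variable {X : Type*} [TopologicalSpace X] {H : HalfDilationStructure X} {T : Triangulation H}

theorem IsGluing.map_corner {τ : T.Side → T.Side} (hτ : T.IsGluing τ) (s : T.Side) :
    T.map (τ s).1 (T.corner (τ s).1 (τ s).2) = T.map s.1 (T.corner s.1 (s.2 + 1)) := by
  have := hτ.map_eq s 1 (by simp)
  rwa [sub_self, pt, pt, sidePoint_zero, sidePoint_one] at this

/-- Two points of the triangles with the same image coincide, or are two corners at a singularity,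
or are two points of open sides that are glued to each other. -/
theorem IsGluing.identification [T2Space X] {τ : T.Side → T.Side} (hτ : T.IsGluing τ)
    {i j : Fin T.n} {z z' : ℂ} (hz : z ∈ T.face i) (hz' : z' ∈ T.face j)
    (h : T.map i z = T.map j z') :
    (i = j ∧ z = z') ∨ (z ∈ Set.range (T.corner i) ∧ z' ∈ Set.range (T.corner j)) ∨
      ∃ s : T.Side, ∃ t ∈ Set.Ioo (0 : ℝ) 1,
        i = s.1 ∧ z = T.pt s t ∧ j = (τ s).1 ∧ z' = T.pt (τ s) (1 - t) := by
  rcases triangle_cases (T.nondegenerate i) hz with hi | ⟨k, rfl⟩ | ⟨k, t, ht, rfl⟩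
  · exact Or.inl ((T.interior_unique hi hz' h.symm).imp Eq.symm Eq.symm)
  · exact Or.inr (Or.inl ⟨⟨k, rfl⟩, T.sing_vertex j z' hz' (h ▸ T.vertex_mem i k)⟩)
  rcases triangle_cases (T.nondegenerate j) hz' with hj | ⟨k', rfl⟩ | ⟨k', t', ht', rfl⟩
  · exact Or.inl (T.interior_unique hj hz h)
  · exact absurd (h ▸ T.vertex_mem j k') (T.map_pt_notMem (i, k) ht)
  · rcases hτ.eq_or_eq (i, k) (j, k') t ht t' ht' h.symm with ⟨e1, e2⟩ | ⟨e1, e2⟩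
    · obtain ⟨rfl, rfl⟩ := Prod.mk.injEq _ _ _ _ ▸ e1
      exact Or.inl ⟨rfl, by rw [e2]⟩
    · refine Or.inr (Or.inr ⟨(i, k), t, ht, rfl, rfl, ?_⟩)
      rw [← e1, ← e2]
      exact ⟨rfl, rfl⟩

theorem isClosed_image [T2Space X] (i : Fin T.n) {K : Set ℂ} (hK : IsClosed K) :
    IsClosed (T.map i '' (T.face i ∩ K)) :=
  (((isCompact_triangle (T.corner i)).inter_right hK).image_of_continuousOn
    ((T.continuousOn i).mono Set.inter_subset_left)).isClosed

/-- Any two triangles are joined by a chain of triangles in which neighbours share a side, as the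
complement of the singularities is connected. -/
theorem IsGluing.connected [T2Space X] {τ : T.Side → T.Side} (hτ : T.IsGluing τ)
    (hX : IsPreconnected (H.sing : Set X)ᶜ) (S : Set (Fin T.n)) (hS : S.Nonempty)
    (hclosed : ∀ s : T.Side, s.1 ∈ S → (τ s).1 ∈ S) : S = Set.univ := by
  by_contra hne
  obtain ⟨i₁, hi₁⟩ := (Set.ne_univ_iff_exists_notMem S).1 hne
  obtain ⟨i₀, hi₀⟩ := hS
  have hcl : ∀ S' : Set (Fin T.n), IsClosed (⋃ i ∈ S', T.map i '' T.face i) := fun S' =>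
    S'.toFinite.isClosed_biUnion fun i _ => by
      simpa using T.isClosed_image i (K := Set.univ) isClosed_univ
  have hhalf : (1 / 2 : ℝ) ∈ Set.Ioo (0 : ℝ) 1 := by norm_num
  have hmem : ∀ (S' : Set (Fin T.n)), ∀ i ∈ S',
      ((H.sing : Set X)ᶜ ∩ ⋃ i ∈ S', T.map i '' T.face i).Nonempty := fun S' i hi =>
    ⟨T.map i (T.pt (i, 0) (1 / 2)), T.map_pt_notMem (i, 0) hhalf,
      Set.mem_biUnion hi ⟨_, T.pt_mem (i, 0) (Set.Ioo_subset_Icc_self hhalf), rfl⟩⟩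
  obtain ⟨x, hx, hxS, hxS'⟩ := isPreconnected_closed_iff.1 hX _ _ (hcl S) (hcl Sᶜ)
    (fun x _ => by
      obtain ⟨i, hi⟩ := T.cover x
      by_cases h : i ∈ S
      · exact Or.inl (Set.mem_biUnion h hi)
      · exact Or.inr (Set.mem_biUnion (show i ∈ Sᶜ from h) hi)) (hmem S i₀ hi₀) (hmem Sᶜ i₁ hi₁)
  obtain ⟨i, hi, z, hz, rfl⟩ := Set.mem_iUnion₂.1 hxS
  obtain ⟨j, hj, z', hz', hzz⟩ := Set.mem_iUnion₂.1 hxS'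
  rcases hτ.identification hz hz' hzz.symm with ⟨rfl, -⟩ | ⟨⟨k, rfl⟩, -⟩ | ⟨s, -, -, rfl, -, rfl, -⟩
  · exact hj hi
  · exact hx (T.vertex_mem i k)
  · exact hj (hclosed s hi)

/-- The combinatorial gluing of the triangles of a triangulation. -/
def toTriangleGluing [T2Space X] {τ : T.Side → T.Side} (hτ : T.IsGluing τ)
    (hX : IsPreconnected (H.sing : Set X)ᶜ) : TriangleGluing (Fin T.n) H.sing where
  pair := τ
  vertex s := ⟨T.map s.1 (T.corner s.1 s.2), T.vertex_mem s.1 s.2⟩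
  pair_pair := hτ.involutive
  face_ne := hτ.face_ne
  vertex_pair s := Subtype.ext (hτ.map_corner s)
  vertex_surjective := by
    rintro ⟨x, hx⟩
    obtain ⟨i, z, hz, rfl⟩ := T.cover x
    obtain ⟨k, rfl⟩ := T.sing_vertex i z hz hx
    exact ⟨(i, k), rfl⟩
  connected := hτ.connected hX

/-- The function on the `i`-th triangle that is affine, has the value `0` at the corner `0`, and
increases by `c (i, j)` along the side `j`, for `j = 0, 1`. -/
noncomputable def develop (c : T.Side → ℤ) (i : Fin T.n) (z : ℂ) : ℝ :=
  bary (T.nondegenerate i) 1 z * c (i, 0) + bary (T.nondegenerate i) 2 z * (c (i, 0) + c (i, 1))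

theorem continuous_develop (c : T.Side → ℤ) (i : Fin T.n) : Continuous (develop c i) :=
  ((continuous_bary _ _).mul continuous_const).add ((continuous_bary _ _).mul continuous_const)

theorem develop_corner (c : T.Side → ℤ) (i : Fin T.n) (j : Fin 3) :
    ∃ m : ℤ, develop c i (T.corner i j) = m := by
  fin_cases j
  · exact ⟨0, by simp [develop, bary_corner]⟩
  · exact ⟨c (i, 0), by simp [develop, bary_corner]⟩
  · exact ⟨c (i, 0) + c (i, 1), by simp [develop, bary_corner]⟩

theorem develop_pt {c : T.Side → ℤ} (hc : ∀ i, ∑ j, c (i, j) = 0) (s : T.Side) (t : ℝ) :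
    develop c s.1 (T.pt s t) = develop c s.1 (T.corner s.1 s.2) + t * c s := by
  obtain ⟨i, j⟩ := s
  have h : (c (i, 0) : ℝ) + c (i, 1) + c (i, 2) = 0 := by
    have := hc i
    rw [Fin.sum_univ_three] at this
    exact_mod_cast this
  simp only [develop, pt, bary_sidePoint, bary_corner]
  fin_cases j <;> simp
  · ring
  · linear_combination (-t) * h

/-- If every map to the circle lifts to the line, every integral cocycle is a coboundary: the
affine functions on the triangles with the increments of the cocycle along the sides fit together to
a map to the circle, and the values of a lift at the vertices have these increments as well. -/
theorem IsGluing.exists_potential [T2Space X] {τ : T.Side → T.Side} (hτ : T.IsGluing τ)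
    (hlift : ∀ f : X → AddCircle (1 : ℝ), Continuous f →
      ∃ g : X → ℝ, Continuous g ∧ ∀ x, (g x : AddCircle (1 : ℝ)) = f x)
    {c : T.Side → ℤ} (hanti : ∀ s, c (τ s) = -c s) (hc : ∀ i, ∑ j, c (i, j) = 0) :
    ∃ p : X → ℤ, ∀ s : T.Side,
      c s = p (T.map s.1 (T.corner s.1 (s.2 + 1))) - p (T.map s.1 (T.corner s.1 s.2)) := by
  have hint : ∀ m : ℤ, ((m : ℝ) : AddCircle (1 : ℝ)) = 0 := fun m =>
    (AddCircle.coe_eq_zero_iff (1 : ℝ)).2 ⟨m, by simp⟩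
  have hcorner : ∀ i j, (develop c i (T.corner i j) : AddCircle (1 : ℝ)) = 0 := fun i j => by
    obtain ⟨m, hm⟩ := develop_corner c i j
    rw [hm, hint]
  -- the developing functions agree modulo integers
  have hagree : ∀ i j z z', z ∈ T.face i → z' ∈ T.face j → T.map i z = T.map j z' →
      (develop c i z : AddCircle (1 : ℝ)) = develop c j z' := by
    intro i j z z' hz hz' h
    rcases hτ.identification hz hz' h with ⟨rfl, rfl⟩ | ⟨⟨k, rfl⟩, ⟨l, rfl⟩⟩ |
      ⟨s, t, -, rfl, rfl, rfl, rfl⟩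
    · rfl
    · rw [hcorner, hcorner]
    · rw [develop_pt hc, develop_pt hc, AddCircle.coe_add, AddCircle.coe_add, hcorner, hcorner,
        hanti]
      have : (1 - t) * ((-c s : ℤ) : ℝ) = t * c s - (c s : ℤ) := by push_cast; ring
      rw [this, AddCircle.coe_sub, hint, sub_zero]
  choose I Z hZ hIZ using T.cover
  let f : X → AddCircle (1 : ℝ) := fun x => (develop c (I x) (Z x) : AddCircle (1 : ℝ))
  have hf : ∀ i, ∀ z ∈ T.face i, f (T.map i z) = develop c i z := fun i z hz =>
    hagree _ _ _ _ (hZ _) hz (hIZ _)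
  have hcont : Continuous f := by
    rw [continuous_iff_isClosed]
    intro C hC
    have : f ⁻¹' C = ⋃ i, T.map i ''
        (T.face i ∩ (fun z => (develop c i z : AddCircle (1 : ℝ))) ⁻¹' C) := by
      ext x
      rw [Set.mem_iUnion]
      constructor
      · exact fun hx => ⟨I x, Z x, ⟨hZ x, hx⟩, hIZ x⟩
      · rintro ⟨i, z, ⟨hz, hzC⟩, rfl⟩
        rw [Set.mem_preimage, hf i z hz]
        exact hzC
    rw [this]
    exact isClosed_iUnion_of_finite fun i => T.isClosed_image i
      (hC.preimage ((AddCircle.continuous_mk' 1).comp (continuous_develop c i)))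
  obtain ⟨g, hg, hgf⟩ := hlift f hcont
  have hm : ∀ i, ∃ m : ℤ, ∀ z ∈ T.face i, g (T.map i z) = develop c i z + m := fun i =>
    exists_int_of_coe_eq (convex_convexHull ℝ _).isPreconnected
      (hg.comp_continuousOn (T.continuousOn i)) (continuous_develop c i).continuousOn
      fun z hz => by rw [hgf, hf i z hz]
  have hvertex : ∀ i j, ((⌊g (T.map i (T.corner i j))⌋ : ℤ) : ℝ) = g (T.map i (T.corner i j)) := by
    intro i j
    obtain ⟨m, hm⟩ := hm i
    obtain ⟨m', hm'⟩ := develop_corner c i j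
    have : g (T.map i (T.corner i j)) = ((m' + m : ℤ) : ℝ) := by
      rw [hm _ (subset_convexHull ℝ _ (Set.mem_range_self j)), hm']; push_cast; rfl
    rw [this, Int.floor_intCast]
  refine ⟨fun x => ⌊g x⌋, fun s => ?_⟩
  obtain ⟨m, hm⟩ := hm s.1
  have h1 := develop_pt hc s 1
  rw [pt, sidePoint_one] at h1
  have : (c s : ℝ) = ((⌊g (T.map s.1 (T.corner s.1 (s.2 + 1)))⌋ -
      ⌊g (T.map s.1 (T.corner s.1 s.2))⌋ : ℤ) : ℝ) := by
    push_cast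
    rw [hvertex, hvertex, hm _ (subset_convexHull ℝ _ (Set.mem_range_self _)),
      hm _ (subset_convexHull ℝ _ (Set.mem_range_self _)), h1]
    ring
  exact_mod_cast this

end Triangulation

/-! ### Gluings of four triangles with four vertices -/

namespace TriangleGluing

variable {F V : Type*} (G : TriangleGluing F V)

/-- A change of the names of the triangles together with rotations of the names of the corners. -/
def sideEquiv {F' : Type*} (A : F' ≃ F) (r : F' → Fin 3) : F' × Fin 3 ≃ F × Fin 3 where
  toFun x := (A x.1, r x.1 + x.2)
  invFun y := (A.symm y.1, y.2 - r (A.symm y.1))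
  left_inv x := by simp
  right_inv y := by simp

/-- The gluing with renamed triangles and rotated names of the corners. -/
def relabel {F' : Type*} (A : F' ≃ F) (r : F' → Fin 3) : TriangleGluing F' V where
  pair x := (sideEquiv A r).symm (G.pair (sideEquiv A r x))
  vertex x := G.vertex (sideEquiv A r x)
  pair_pair x := by simp [G.pair_pair]
  face_ne x := by
    intro h
    have := congrArg A h
    simp only [sideEquiv, Equiv.coe_fn_symm_mk, Equiv.apply_symm_apply, Equiv.coe_fn_mk] at this
    exact G.face_ne _ this
  vertex_pair x := by
    rw [Equiv.apply_symm_apply, G.vertex_pair]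
    simp [next, sideEquiv, add_assoc]
  vertex_surjective := G.vertex_surjective.comp (sideEquiv A r).surjective
  connected S hS hcl := by
    have h := G.connected (A '' S) (hS.image A) (by
      rintro ⟨f, j⟩ ⟨m, hm, rfl⟩
      obtain ⟨x, hx⟩ := (sideEquiv A r).surjective (A m, j)
      have hxm : x.1 = m := A.injective (congrArg Prod.fst hx)
      refine ⟨_, hcl x (hxm ▸ hm), ?_⟩
      rw [hx]
      simp [sideEquiv])
    rw [← Set.image_univ_of_surjective A.surjective] at h
    exact A.injective.image_injective h

theorem relabel_pair_iff {F' : Type*} (A : F' ≃ F) (r : F' → Fin 3) (x y : F' × Fin 3) :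
    (G.relabel A r).pair x = y ↔ G.pair (A x.1, r x.1 + x.2) = (A y.1, r y.1 + y.2) := by
  change (sideEquiv A r).symm _ = y ↔ _
  rw [Equiv.symm_apply_eq]; rfl

/-- The gluing has the combinatorial type with the names `v` of the vertices and `s` of the
undirected edges, where the name `s m a` belongs to the side opposite to the corner `a`. -/
def HasNames (v : Fin 4 → Fin 3 → Fin 4) (s : Fin 4 → Fin 3 → Fin 6) : Prop :=
  ∃ (A : Fin 4 ≃ F) (ρ : Fin 4 → Equiv.Perm (Fin 3)) (W : Fin 4 ≃ V),
    (∀ m a, G.vertex (A m, ρ m a) = W (v m a)) ∧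
    ∀ m a m' a', s m a = s m' a' ↔ (A m, ρ m a + 1) = (A m', ρ m' a' + 1) ∨
      (A m, ρ m a + 1) = G.pair (A m', ρ m' a' + 1)

theorem HasNames.of_relabel {v : Fin 4 → Fin 3 → Fin 4} {s : Fin 4 → Fin 3 → Fin 6}
    {A : Fin 4 ≃ F} {r : Fin 4 → Fin 3} (h : (G.relabel A r).HasNames v s) : G.HasNames v s := by
  obtain ⟨A', ρ, W, h1, h2⟩ := h
  refine ⟨A'.trans A, fun m => (ρ m).trans (Equiv.addLeft (r (A' m))), W, h1, ?_⟩
  intro m a m' a'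
  rw [h2, eq_comm (b := (G.relabel A r).pair _), relabel_pair_iff, eq_comm (b := G.pair _),
    ← (sideEquiv A r).injective.eq_iff]
  simp [sideEquiv, add_assoc]

theorem pair_injective : Function.Injective G.pair :=
  Function.LeftInverse.injective (g := G.pair) G.pair_pair

/-- A gluing of the triangles `0, 1, 2, 3` with known pairing and names of the vertices. -/
theorem hasNames_of_pair {V : Type*} [Fintype V] (hV : Fintype.card V = 4)
    (G : TriangleGluing (Fin 4) V) (v : Fin 4 → Fin 3 → Fin 4) (s : Fin 4 → Fin 3 → Fin 6)
    (ρ : Fin 4 → Equiv.Perm (Fin 3)) (W : Fin 4 → V)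
    (hW : ∀ m a, G.vertex (m, ρ m a) = W (v m a))
    (hs : ∀ m a m' a', s m a = s m' a' ↔ (m, ρ m a + 1) = (m', ρ m' a' + 1) ∨
      (m, ρ m a + 1) = G.pair (m', ρ m' a' + 1)) : G.HasNames v s := by
  have hsurj : Function.Surjective W := by
    intro x
    obtain ⟨⟨m, j⟩, rfl⟩ := G.vertex_surjective x
    exact ⟨v m ((ρ m).symm j), by rw [← hW, Equiv.apply_symm_apply]⟩
  have hbij : Function.Bijective W :=
    (Fintype.bijective_iff_surjective_and_card W).2 ⟨hsurj, by simp [hV]⟩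
  exact ⟨Equiv.refl _, ρ, Equiv.ofBijective W hbij, hW, hs⟩

/-- The vertices of the tetrahedral triangulation. -/
def tetraVertex : Fin 4 → Fin 3 → Fin 4 := ![![1, 2, 3], ![0, 2, 3], ![0, 1, 3], ![0, 1, 2]]

/-- The edges of the tetrahedral triangulation. -/
def tetraEdge : Fin 4 → Fin 3 → Fin 6 := ![![5, 4, 3], ![5, 2, 1], ![4, 2, 0], ![3, 1, 0]]

/-- The vertices of the triangulation by two bigons. -/
def bigonVertex : Fin 4 → Fin 3 → Fin 4 := ![![0, 1, 2], ![0, 1, 2], ![0, 1, 3], ![0, 1, 3]]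

/-- The edges of the triangulation by two bigons. -/
def bigonEdge : Fin 4 → Fin 3 → Fin 6 := ![![2, 3, 0], ![2, 3, 1], ![4, 5, 0], ![4, 5, 1]]

/-- The pairing of the sides of the tetrahedral triangulation, after the corners of the triangles
`1` and `3` have been reordered so that the orientations fit. -/
def tetraPair : Fin 4 × Fin 3 → Fin 4 × Fin 3 := fun x =>
  (![![(3, 1), (1, 1), (2, 1)], ![(2, 2), (0, 1), (3, 0)], ![(3, 2), (0, 2), (1, 0)],
    ![(1, 2), (0, 0), (2, 0)]] : Fin 4 → Fin 3 → Fin 4 × Fin 3) x.1 x.2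

/-- The pairing of the sides of the triangulation by two bigons, after the corners of the triangles
`1` and `2` have been reordered so that the orientations fit. -/
def bigonPair : Fin 4 × Fin 3 → Fin 4 × Fin 3 := fun x =>
  (![![(2, 0), (1, 2), (1, 1)], ![(3, 0), (0, 2), (0, 1)], ![(0, 0), (3, 2), (3, 1)],
    ![(1, 0), (2, 2), (2, 1)]] : Fin 4 → Fin 3 → Fin 4 × Fin 3) x.1 x.2

theorem hasNames_tetra {V : Type*} [Fintype V] (hV : Fintype.card V = 4)
    (G : TriangleGluing (Fin 4) V) (hG : ∀ x, G.pair x = tetraPair x) :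
    G.HasNames tetraVertex tetraEdge := by
  have e : ∀ m j, G.vertex (tetraPair (m, j)) = G.vertex (m, j + 1) := fun m j => by
    rw [← hG, G.vertex_pair]; rfl
  refine hasNames_of_pair hV G _ _ ![1, Equiv.swap 1 2, 1, Equiv.swap 1 2]
    ![G.vertex (1, 0), G.vertex (0, 0), G.vertex (0, 1), G.vertex (0, 2)] ?_ ?_
  · simp [Fin.forall_fin_succ, tetraPair, tetraVertex] at e ⊢
    grind
  · simp only [hG]; decide

theorem hasNames_bigon {V : Type*} [Fintype V] (hV : Fintype.card V = 4)
    (G : TriangleGluing (Fin 4) V) (hG : ∀ x, G.pair x = bigonPair x) :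
    G.HasNames bigonVertex bigonEdge := by
  have e : ∀ m j, G.vertex (bigonPair (m, j)) = G.vertex (m, j + 1) := fun m j => by
    rw [← hG, G.vertex_pair]; rfl
  refine hasNames_of_pair hV G _ _ ![1, Equiv.swap 0 1, Equiv.swap 0 1, 1]
    ![G.vertex (0, 0), G.vertex (0, 1), G.vertex (0, 2), G.vertex (2, 2)] ?_ ?_
  · simp [Fin.forall_fin_succ, bigonPair, bigonVertex] at e ⊢
    grind
  · simp only [hG]; decide

/-- A function of four triangles that takes different values is a bijection. -/
theorem exists_equiv_of_ne [Fintype F] (hF : Fintype.card F = 4) {a b c d : F} (hab : a ≠ b)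
    (hac : a ≠ c) (had : a ≠ d) (hbc : b ≠ c) (hbd : b ≠ d) (hcd : c ≠ d) :
    ∃ A : Fin 4 ≃ F, A 0 = a ∧ A 1 = b ∧ A 2 = c ∧ A 3 = d := by
  have hinj : Function.Injective ![a, b, c, d] := by
    intro i j h
    fin_cases i <;> fin_cases j <;> simp_all
  have hbij := (Fintype.bijective_iff_injective_and_card ![a, b, c, d]).2 ⟨hinj, by simp [hF]⟩
  exact ⟨Equiv.ofBijective _ hbij, rfl, rfl, rfl, rfl⟩

/-- Two triangles `0` and `1` that are glued along two sides around a vertex form a bigon. If the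
other two triangles are attached to its sides, they form a bigon as well; the only other way to glue
them produces too few vertices. -/
theorem hasNames_of_bigon_labelled [Fintype V] (hV : Fintype.card V = 4)
    {G : TriangleGluing (Fin 4) V} (h01 : G.pair (0, 1) = (1, 2)) (h11 : G.pair (1, 1) = (0, 2))
    (h00 : G.pair (0, 0) = (2, 0)) (h10 : G.pair (1, 0) = (3, 0)) :
    G.HasNames bigonVertex bigonEdge := by
  have inv : ∀ {x y}, G.pair x = y → G.pair y = x := fun h => by rw [← h, G.pair_pair]
  have h12 := inv h01
  have h02 := inv h11
  have h20 := inv h00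
  have h30 := inv h10
  have hne : ∀ {x y z}, G.pair x = y → x ≠ z → G.pair z ≠ y := fun h hxz hz =>
    hxz (G.pair_injective (h.trans hz.symm))
  have hface2 : ∀ j, j ≠ 0 → (G.pair (2, j)).1 = 3 ∧ (G.pair (2, j)).2 ≠ 0 := by
    intro j hj
    have hf : (G.pair (2, j)).1 ≠ 2 := G.face_ne (2, j)
    have a0 := hne h20 (z := (2, j)) (by simpa using Ne.symm hj)
    have a1 := hne h02 (z := (2, j)) (by simp)
    have a2 := hne h12 (z := (2, j)) (by simp)
    have a3 := hne h11 (z := (2, j)) (by simp)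
    have a4 := hne h01 (z := (2, j)) (by simp)
    have a5 := hne h30 (z := (2, j)) (by simp)
    have a6 := hne h10 (z := (2, j)) (by simp)
    generalize G.pair (2, j) = y at *
    revert y
    decide
  obtain ⟨f1, g1⟩ := hface2 1 (by decide)
  obtain ⟨f2, g2⟩ := hface2 2 (by decide)
  have h12ne : G.pair (2, 1) ≠ G.pair (2, 2) := fun h => by
    have := G.pair_injective h
    simp at this
  have hcases : (G.pair (2, 1) = (3, 1) ∧ G.pair (2, 2) = (3, 2)) ∨
      (G.pair (2, 1) = (3, 2) ∧ G.pair (2, 2) = (3, 1)) := by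
    generalize G.pair (2, 1) = y at *
    generalize G.pair (2, 2) = z at *
    clear h01 h11 h00 h10 h12 h02 h20 h30 inv hne hface2
    revert y z
    decide
  rcases hcases with ⟨h21, h22⟩ | ⟨h21, h22⟩
  · exfalso
    have h31 := inv h21
    have h32 := inv h22
    have e : ∀ {x y}, G.pair x = y → G.vertex y = G.vertex (x.1, x.2 + 1) := fun h => by
      rw [← h, G.vertex_pair]; rfl
    have e01 := e h01
    have e11 := e h11
    have e00 := e h00
    have e10 := e h10
    have e12 := e h12
    have e02 := e h02
    have e20 := e h20
    have e30 := e h30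
    have e21 := e h21
    have e22 := e h22
    have e31 := e h31
    have e32 := e h32
    simp only [Fin.isValue, Fin.reduceAdd, zero_add] at *
    have hval : ∀ x, ∃ b : Bool, G.vertex x = cond b (G.vertex (0, 0)) (G.vertex (0, 2)) := by
      rintro ⟨m, j⟩
      fin_cases m <;> fin_cases j <;>
        simp only [Fin.zero_eta, Fin.mk_one, Fin.reduceFinMk, Bool.exists_bool, cond_true,
          cond_false] <;> grind
    have hle := Fintype.card_le_of_surjective
      (fun b : Bool => cond b (G.vertex (0, 0)) (G.vertex (0, 2))) (fun v => by
        obtain ⟨x, rfl⟩ := G.vertex_surjective v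
        obtain ⟨b, hb⟩ := hval x
        exact ⟨b, hb.symm⟩)
    rw [hV] at hle
    simp at hle
  · have h31 := inv h22
    have h32 := inv h21
    refine hasNames_bigon hV G ?_
    rintro ⟨m, j⟩
    fin_cases m <;> fin_cases j <;> assumption

/-- The two outer sides of a bigon are not glued to the same triangle: the fourth triangle would
have no partners for its sides. -/
theorem false_of_bigon_labelled {G : TriangleGluing (Fin 4) V} {p q : Fin 3}
    (h01 : G.pair (0, 1) = (1, 2)) (h11 : G.pair (1, 1) = (0, 2))
    (h00 : G.pair (0, 0) = (2, p)) (h10 : G.pair (1, 0) = (2, q)) : False := by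
  have inv : ∀ {x y}, G.pair x = y → G.pair y = x := fun h => by rw [← h, G.pair_pair]
  have hne : ∀ {x y} z, G.pair x = y → x ≠ z → G.pair z ≠ y := fun z h hxz hz =>
    hxz (G.pair_injective (h.trans hz.symm))
  have h3 : ∀ j, ∃ k, G.pair (3, j) = (2, k) ∧ k ≠ p ∧ k ≠ q := by
    intro j
    have hf : (G.pair (3, j)).1 ≠ 3 := G.face_ne (3, j)
    have a0 := hne (3, j) h01 (by simp)
    have a1 := hne (3, j) (inv h01) (by simp)
    have a2 := hne (3, j) h11 (by simp)
    have a3 := hne (3, j) (inv h11) (by simp)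
    have a4 := hne (3, j) h00 (by simp)
    have a5 := hne (3, j) (inv h00) (by simp)
    have a6 := hne (3, j) h10 (by simp)
    have a7 := hne (3, j) (inv h10) (by simp)
    have h2 : (G.pair (3, j)).1 = 2 := by
      clear a4 a6
      generalize G.pair (3, j) = y at *
      revert y
      decide
    refine ⟨(G.pair (3, j)).2, Prod.ext h2 rfl, fun h => a4 (Prod.ext h2 h),
      fun h => a6 (Prod.ext h2 h)⟩
  obtain ⟨k0, e0, n0⟩ := h3 0
  obtain ⟨k1, e1, n1⟩ := h3 1
  obtain ⟨k2, e2, n2⟩ := h3 2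
  have d : ∀ {x y : Fin 4 × Fin 3} {k k' : Fin 3}, x ≠ y → G.pair x = (2, k) →
      G.pair y = (2, k') → k ≠ k' := fun hxy h h' hk =>
    hxy (G.pair_injective (by rw [h, h', hk]))
  have d0 := d (by simp) e0 e1
  have d1 := d (by simp) e0 e2
  have d2 := d (by simp) e1 e2
  omega

/-- A vertex with two triangles around it leads to the type with two bigons. -/
theorem hasNames_of_bigon [Fintype F] (hF : Fintype.card F = 4) [Fintype V]
    (hV : Fintype.card V = 4) {x y : F × Fin 3} (hx : G.pair x = next y) (hy : G.pair y = next x) :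
    G.HasNames bigonVertex bigonEdge := by
  obtain ⟨i, a⟩ := x
  obtain ⟨i', b⟩ := y
  have hii : i ≠ i' := fun h => G.face_ne (i, a) (by rw [hx]; exact h.symm)
  have hx' : G.pair (i', b + 1) = (i, a) := by
    have := G.pair_pair (i, a); rwa [hx] at this
  have hy' : G.pair (i, a + 1) = (i', b) := by
    have := G.pair_pair (i', b); rwa [hy] at this
  simp only [next] at hx hy
  -- if the outer sides of the bigon are not glued to each other, they are glued to other triangles
  have hout : ∀ {f g : F} {a b : Fin 3}, G.pair (f, a) = (g, b + 1) → G.pair (g, b) = (f, a + 1) →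
      G.pair (f, a + 2) ≠ (g, b + 2) → (G.pair (f, a + 2)).1 ≠ g := by
    intro f g a b h1 h2 h3 h
    have h1' : G.pair (g, b + 1) = (f, a) := by
      have := G.pair_pair (f, a); rwa [h1] at this
    obtain ⟨k, hk⟩ : ∃ k, G.pair (f, a + 2) = (g, k) := ⟨_, Prod.ext h rfl⟩
    have hk' : G.pair (g, k) = (f, a + 2) := by
      have := G.pair_pair (f, a + 2); rwa [hk] at this
    have hn := fin3_ne a
    rcases fin3_cases k b with rfl | rfl | rfl
    · rw [h2, Prod.mk.injEq] at hk'; exact hn.2.2.1 hk'.2.symm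
    · rw [h1', Prod.mk.injEq] at hk'; exact hn.2.1 hk'.2.symm
    · exact h3 hk
  have hsep : G.pair (i, a + 2) ≠ (i', b + 2) := by
    intro h
    have h' : G.pair (i', b + 2) = (i, a + 2) := by
      have := G.pair_pair (i, a + 2); rwa [h] at this
    have hall := G.connected {i, i'} ⟨i, by simp⟩ (by
      rintro ⟨f, k⟩ (hf | hf) <;> simp only at hf <;> subst hf
      · rcases fin3_cases k a with rfl | rfl | rfl <;> simp [hx, hy', h]
      · rcases fin3_cases k b with rfl | rfl | rfl <;> simp [hx', hy, h'])
    have : Fintype.card F ≤ 2 := by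
      classical
      rw [← Finset.card_univ, ← Set.toFinset_univ, ← Set.toFinset_congr hall]
      simpa using Finset.card_le_two (a := i) (b := i')
    omega
  have hsep' : G.pair (i', b + 2) ≠ (i, a + 2) := fun h => hsep (by rw [← h, G.pair_pair])
  have k1 := G.face_ne (i, a + 2)
  have k2 := hout hx hy hsep
  have l1 := G.face_ne (i', b + 2)
  have l2 := hout hy hx hsep'
  obtain ⟨k, p, hk⟩ : ∃ k p, G.pair (i, a + 2) = (k, p) := ⟨_, _, rfl⟩
  obtain ⟨l, q, hl⟩ : ∃ l q, G.pair (i', b + 2) = (l, q) := ⟨_, _, rfl⟩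
  rw [hk] at k1 k2
  rw [hl] at l1 l2
  simp only at k1 k2 l1 l2
  by_cases hkl : k = l
  · exfalso
    subst hkl
    obtain ⟨m, hm⟩ : ∃ m, m ∉ ({i, i', k} : Set F) := by
      by_contra! hcon
      classical
      have := (Finset.card_le_card (s := Finset.univ) (t := {i, i', k})
        fun m _ => by simpa using hcon m).trans Finset.card_le_three
      rw [Finset.card_univ] at this
      omega
    simp only [Set.mem_insert_iff, Set.mem_singleton_iff, not_or] at hm
    obtain ⟨A, A0, A1, A2, A3⟩ := exists_equiv_of_ne hF hii k1.symm (Ne.symm hm.1) k2.symm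
      (Ne.symm hm.2.1) (Ne.symm hm.2.2)
    refine false_of_bigon_labelled (G := G.relabel A ![a + 2, b + 2, 0, 0]) (p := p) (q := q)
      ?_ ?_ ?_ ?_ <;> rw [relabel_pair_iff] <;> simp [A0, A1, A2, add_assoc, hx, hy, hk, hl]
  · obtain ⟨A, A0, A1, A2, A3⟩ := exists_equiv_of_ne hF hii k1.symm l2.symm k2.symm l1.symm hkl
    refine HasNames.of_relabel G (A := A) (r := ![a + 2, b + 2, p, q])
      (hasNames_of_bigon_labelled hV ?_ ?_ ?_ ?_) <;> rw [relabel_pair_iff] <;>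
      simp [A0, A1, A2, A3, add_assoc, hx, hy, hk, hl]

/-- If no vertex has two triangles around it, then there are three around every vertex. Going around
the vertex at the end of a side therefore leads back after three triangles. -/
theorem pair_prev_pair [Fintype F] (hF : Fintype.card F = 4) [Fintype V]
    (hV : Fintype.card V = 4) (hno : ∀ x y, G.pair x = next y → G.pair y ≠ next x)
    (f g : F) (j k : Fin 3) (h : G.pair (f, j) = (g, k)) :
    G.pair (g, k + 2) = next (G.pair (f, j + 1)) := by
  classical
  -- the rotation around the start of a side
  let φ : F × Fin 3 → F × Fin 3 := fun s => G.pair (s.1, s.2 + 2)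
  have hnext : ∀ s : F × Fin 3, next (s.1, s.2 + 2) = s := fun s => by
    simp [next, add_assoc]
  have hφv : ∀ s, G.vertex (φ s) = G.vertex s := fun s => by
    rw [G.vertex_pair, hnext]
  have hφi : Function.Injective φ := fun s t hst => by
    have := congrArg next (G.pair_injective hst)
    rwa [hnext, hnext] at this
  have h1 : ∀ s, φ s ≠ s := fun s hs =>
    G.face_ne (s.1, s.2 + 2) (show (φ s).1 = s.1 by rw [hs])
  have h2 : ∀ s, φ (φ s) ≠ s := fun s hs => by
    refine hno (s.1, s.2 + 2) ((φ s).1, (φ s).2 + 2) ?_ ?_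
    · rw [hnext]
    · rw [hnext]; exact hs
  let fib : V → Finset (F × Fin 3) := fun v => Finset.univ.filter fun s => G.vertex s = v
  have hsub : ∀ s, {s, φ s, φ (φ s)} ⊆ fib (G.vertex s) := fun s x hx => by
    simp only [Finset.mem_insert, Finset.mem_singleton] at hx
    simp only [fib, Finset.mem_filter, Finset.mem_univ, true_and]
    rcases hx with rfl | rfl | rfl <;> simp [hφv]
  have hthree : ∀ s, ({s, φ s, φ (φ s)} : Finset (F × Fin 3)).card = 3 := fun s =>
    Finset.card_eq_three.2 ⟨_, _, _, (h1 s).symm, (h2 s).symm, (h1 (φ s)).symm, rfl⟩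
  have hge : ∀ v, 3 ≤ (fib v).card := fun v => by
    obtain ⟨s, rfl⟩ := G.vertex_surjective v
    exact (hthree s).ge.trans (Finset.card_le_card (hsub s))
  have hsum : ∑ v, (fib v).card = ∑ _v : V, 3 := by
    rw [← Finset.card_eq_sum_card_fiberwise (f := G.vertex) (s := Finset.univ)
      (fun _ _ => by simp)]
    simp [hF, hV]
  have hcard : ∀ v, (fib v).card = 3 := fun v =>
    ((Finset.sum_eq_sum_iff_of_le fun v _ => hge v).1 hsum.symm v (Finset.mem_univ v)).symm
  have h3 : ∀ s, φ (φ (φ s)) = s := fun s => by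
    have heq := Finset.eq_of_subset_of_card_le (hsub s) (by rw [hcard, hthree])
    have hmem : φ (φ (φ s)) ∈ ({s, φ s, φ (φ s)} : Finset (F × Fin 3)) := by
      rw [heq]; simp [fib, hφv]
    simp only [Finset.mem_insert, Finset.mem_singleton] at hmem
    rcases hmem with h | h | h
    · exact h
    · exact absurd (hφi h) (h2 s)
    · exact absurd h (h1 _)
  have h4 := h3 (f, j + 1)
  have e1 : φ (f, j + 1) = (g, k) := by
    simp only [φ, add_assoc]
    simpa using h
  rw [e1] at h4
  have h5 : G.pair (f, j + 1) = ((φ (g, k)).1, (φ (g, k)).2 + 2) := by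
    rw [← h4]; exact G.pair_pair _
  rw [h5, hnext]

/-- If no vertex has two triangles around it, the gluing is tetrahedral. -/
theorem hasNames_of_no_bigon [Fintype F] (hF : Fintype.card F = 4) [Fintype V]
    (hV : Fintype.card V = 4) (hno : ∀ x y, G.pair x = next y → G.pair y ≠ next x) :
    G.HasNames tetraVertex tetraEdge := by
  have key := G.pair_prev_pair hF hV hno
  obtain ⟨f⟩ : Nonempty F := Fintype.card_pos_iff.1 (by omega)
  obtain ⟨d, d', h0⟩ : ∃ d d', G.pair (f, 0) = (d, d') := ⟨_, _, rfl⟩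
  obtain ⟨b, b', h1⟩ : ∃ b b', G.pair (f, 1) = (b, b') := ⟨_, _, rfl⟩
  obtain ⟨c, c', h2⟩ : ∃ c c', G.pair (f, 2) = (c, c') := ⟨_, _, rfl⟩
  have k0 := key f d 0 d' h0
  have k1 := key f b 1 b' h1
  have k2 := key f c 2 c' h2
  simp only [zero_add, Fin.reduceAdd, h0, h1, h2, next] at k0 k1 k2
  have n0 := G.face_ne (f, 0)
  have n1 := G.face_ne (f, 1)
  have n2 := G.face_ne (f, 2)
  have m0 := G.face_ne (d, d' + 2)
  have m1 := G.face_ne (b, b' + 2)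
  have m2 := G.face_ne (c, c' + 2)
  rw [h0] at n0
  rw [h1] at n1
  rw [h2] at n2
  rw [k0] at m0
  rw [k1] at m1
  rw [k2] at m2
  simp only at n0 n1 n2 m0 m1 m2
  obtain ⟨A, A0, A1, A2, A3⟩ := exists_equiv_of_ne hF n1.symm n2.symm n0.symm m1.symm m0 m2.symm
  have inv : ∀ {x y}, G.pair x = y → G.pair y = x := fun h => by rw [← h, G.pair_pair]
  have h0' := inv h0
  have h1' := inv h1
  have h2' := inv h2
  have k0' := inv k0
  have k1' := inv k1
  have k2' := inv k2
  refine HasNames.of_relabel G (A := A) (r := ![0, b' + 2, c' + 2, d' + 2])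
    (hasNames_tetra hV _ ?_)
  rintro ⟨m, j⟩
  rw [relabel_pair_iff]
  fin_cases m <;> fin_cases j <;> simp [tetraPair, add_assoc, *]

/-- Four triangles glued to a surface with four vertices form one of two combinatorial types. -/
theorem hasNames_or [Fintype F] (hF : Fintype.card F = 4) [Fintype V] (hV : Fintype.card V = 4) :
    G.HasNames tetraVertex tetraEdge ∨ G.HasNames bigonVertex bigonEdge := by
  by_cases h : ∃ x y, G.pair x = next y ∧ G.pair y = next x
  · obtain ⟨x, y, hx, hy⟩ := h
    exact Or.inr (G.hasNames_of_bigon hF hV hx hy)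
  · push Not at h
    exact Or.inl (G.hasNames_of_no_bigon hF hV h)

end TriangleGluing

/-! ### Combinatorial types of triangulations -/

theorem opposite_perm (ρ : Equiv.Perm (Fin 3)) {a b : Fin 3} (h : a ≠ b) :
    ρ (-(a + b)) = -(ρ a + ρ b) := by
  revert ρ a b; decide

namespace Triangulation

variable {X : Type*} [TopologicalSpace X] {H : HalfDilationStructure X} {T : Triangulation H}

/-- A side with chosen direction is one of the sides `pt`, or the reverse of one of them. -/
theorem lineMap_corner (T : Triangulation H) (f : Fin T.n) {a b : Fin 3} (h : a ≠ b) :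
    (b = a + 1 ∧ -(a + b) + 1 = a ∧
        ∀ t, AffineMap.lineMap (T.corner f a) (T.corner f b) t = T.pt (f, a) t) ∨
      (a = b + 1 ∧ -(a + b) + 1 = b ∧
        ∀ t, AffineMap.lineMap (T.corner f a) (T.corner f b) t = T.pt (f, b) (1 - t)) := by
  have hcases : (b = a + 1 ∧ -(a + b) + 1 = a) ∨ (a = b + 1 ∧ -(a + b) + 1 = b) := by
    revert a b; decide
  rcases hcases with ⟨rfl, h2⟩ | ⟨rfl, h2⟩
  · exact Or.inl ⟨rfl, h2, fun t => rfl⟩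
  · exact Or.inr ⟨rfl, h2, fun t => (AffineMap.lineMap_apply_one_sub _ _ t).symm⟩

/-- If no edge is a loop, two directed sides are the same edge exactly if the sides are equal or
glued to each other and the endpoints agree. -/
theorem IsGluing.edge_iff {τ : T.Side → T.Side} (hτ : T.IsGluing τ)
    (hloop : ∀ f a b, a ≠ b → T.map f (T.corner f a) ≠ T.map f (T.corner f b))
    {f g : Fin T.n} {a b c d : Fin 3} (hab : a ≠ b) (hcd : c ≠ d) :
    T.scheme.edge f a b g c d ↔
      ((f, -(a + b) + 1) = (g, -(c + d) + 1) ∨ (f, -(a + b) + 1) = τ (g, -(c + d) + 1)) ∧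
        T.map f (T.corner f a) = T.map g (T.corner g c) ∧
        T.map f (T.corner f b) = T.map g (T.corner g d) := by
  have hthird : (1 / 3 : ℝ) ∈ Set.Icc (0 : ℝ) 1 := by norm_num
  have ho : (1 / 3 : ℝ) ∈ Set.Ioo (0 : ℝ) 1 := by norm_num
  have ho' : (1 - 1 / 3 : ℝ) ∈ Set.Ioo (0 : ℝ) 1 := by norm_num
  have hflip : ∀ t ∈ Set.Icc (0 : ℝ) 1, 1 - t ∈ Set.Icc (0 : ℝ) 1 := fun t ht =>
    ⟨by linarith [ht.2], by linarith [ht.1]⟩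
  constructor
  · intro h
    have h' : ∀ t ∈ Set.Icc (0 : ℝ) 1,
      T.map f (AffineMap.lineMap (T.corner f a) (T.corner f b) t) =
        T.map g (AffineMap.lineMap (T.corner g c) (T.corner g d) t) := h
    refine ⟨?_, by simpa using h' 0 (by simp), by simpa using h' 1 (by simp)⟩
    have h3 := h' _ hthird
    rcases T.lineMap_corner f hab with ⟨-, e1, l1⟩ | ⟨-, e1, l1⟩ <;>
      rcases T.lineMap_corner g hcd with ⟨-, e2, l2⟩ | ⟨-, e2, l2⟩ <;>
      rw [l1, l2] at h3 <;> rw [e1, e2]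
    · exact (hτ.eq_or_eq (g, c) (f, a) _ ho _ ho h3).imp And.left And.left
    · exact (hτ.eq_or_eq (g, d) (f, a) _ ho' _ ho h3).imp And.left And.left
    · exact (hτ.eq_or_eq (g, c) (f, b) _ ho _ ho' h3).imp And.left And.left
    · exact (hτ.eq_or_eq (g, d) (f, b) _ ho' _ ho' h3).imp And.left And.left
  · rintro ⟨hs, hac, hbd⟩ t ht
    rcases T.lineMap_corner f hab with ⟨b1, e1, l1⟩ | ⟨b1, e1, l1⟩ <;>
      rcases T.lineMap_corner g hcd with ⟨d1, e2, l2⟩ | ⟨d1, e2, l2⟩ <;>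
      rw [l1, l2] <;> rw [e1, e2] at hs <;> rcases hs with hs | hs
    · rw [Prod.mk.injEq] at hs
      obtain ⟨rfl, rfl⟩ := hs
      rfl
    · have := hτ.map_corner (g, c)
      rw [← hs] at this
      simp only [← d1] at this
      exact absurd (hac.symm.trans this) (hloop g c d hcd)
    · rw [Prod.mk.injEq] at hs
      obtain ⟨rfl, rfl⟩ := hs
      rw [d1] at hac
      exact absurd hac (hloop _ _ _ (fin3_ne _).2.2.2.1)
    · have := hτ.map_eq (g, d) (1 - t) (hflip t ht)
      rwa [← hs, sub_sub_cancel] at this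
    · rw [Prod.mk.injEq] at hs
      obtain ⟨rfl, rfl⟩ := hs
      rw [b1] at hac
      exact absurd hac (hloop _ _ _ (fin3_ne _).1)
    · have := hτ.map_eq (g, c) t ht
      rwa [← hs] at this
    · rw [Prod.mk.injEq] at hs
      obtain ⟨rfl, rfl⟩ := hs
      rfl
    · have := hτ.map_corner (g, d)
      rw [← hs] at this
      simp only [← d1] at this
      exact absurd (hbd.symm.trans this) (hloop g d c hcd.symm)

/-- The names of vertices and edges of the gluing determine the combinatorial type and the numbers
of faces around the vertices. -/
theorem IsGluing.sameType_ofNames [T2Space X] {τ : T.Side → T.Side} (hτ : T.IsGluing τ)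
    (hX : IsPreconnected (H.sing : Set X)ᶜ) {v : Fin 4 → Fin 3 → Fin 4}
    {s : Fin 4 → Fin 3 → Fin 6} (hv : ∀ m, Function.Injective (v m))
    (h : (toTriangleGluing hτ hX).HasNames v s) :
    T.scheme.SameType (Scheme.ofNames v s) ∧
      T.degrees = (Finset.univ : Finset (Fin 4)).val.map
        fun k => Fintype.card {x : Fin 4 × Fin 3 // v x.1 x.2 = k} := by
  obtain ⟨A, ρ, W, h1, h2⟩ := h
  have hvert : ∀ m a, T.map (A m) (T.corner (A m) (ρ m a)) = W (v m a) := fun m a =>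
    congrArg Subtype.val (h1 m a)
  have hW : Function.Injective fun k => (W k : X) := Subtype.val_injective.comp W.injective
  have hvertex : ∀ m a m' a', T.map (A m) (T.corner (A m) (ρ m a)) =
      T.map (A m') (T.corner (A m') (ρ m' a')) ↔ v m a = v m' a' := fun m a m' a' => by
    rw [hvert, hvert]; exact hW.eq_iff
  have hloop : ∀ f a b, a ≠ b → T.map f (T.corner f a) ≠ T.map f (T.corner f b) := by
    intro f a b hab
    obtain ⟨m, rfl⟩ := A.surjective f
    obtain ⟨a, rfl⟩ := (ρ m).surjective a
    obtain ⟨b, rfl⟩ := (ρ m).surjective b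
    rw [Ne, hvertex]
    exact fun h => hab (congrArg _ (hv m h))
  refine ⟨⟨A.symm, fun f => (ρ (A.symm f)).symm, ?_, ?_⟩, ?_⟩
  · intro f a g c
    obtain ⟨m, rfl⟩ := A.surjective f
    obtain ⟨a, rfl⟩ := (ρ m).surjective a
    obtain ⟨m', rfl⟩ := A.surjective g
    obtain ⟨c, rfl⟩ := (ρ m').surjective c
    change _ ↔ v (A.symm (A m)) ((ρ (A.symm (A m))).symm (ρ m a)) =
      v (A.symm (A m')) ((ρ (A.symm (A m'))).symm (ρ m' c))
    simp only [Equiv.symm_apply_apply]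
    exact hvertex m a m' c
  · intro f a b g c d hab hcd
    obtain ⟨m, rfl⟩ := A.surjective f
    obtain ⟨a, rfl⟩ := (ρ m).surjective a
    obtain ⟨b, rfl⟩ := (ρ m).surjective b
    obtain ⟨m', rfl⟩ := A.surjective g
    obtain ⟨c, rfl⟩ := (ρ m').surjective c
    obtain ⟨d, rfl⟩ := (ρ m').surjective d
    have hab' : a ≠ b := fun h => hab (congrArg _ h)
    have hcd' : c ≠ d := fun h => hcd (congrArg _ h)
    simp only [Equiv.symm_apply_apply]
    refine (hτ.edge_iff hloop hab hcd).trans ?_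
    rw [hvertex, hvertex, ← opposite_perm _ hab', ← opposite_perm _ hcd']
    change _ ↔ s (A.symm (A m)) _ = s (A.symm (A m')) _ ∧
      v (A.symm (A m)) a = v (A.symm (A m')) c ∧ v (A.symm (A m)) b = v (A.symm (A m')) d
    simp only [Equiv.symm_apply_apply]
    exact and_congr (h2 m (-(a + b)) m' (-(c + d))).symm Iff.rfl
  · have hval : H.sing.val = (Finset.univ : Finset (Fin 4)).val.map fun k => (W k : X) := by
      have : H.sing = Finset.univ.map ⟨fun k => (W k : X), hW⟩ := by
        ext x
        simp only [Finset.mem_map, Finset.mem_univ, true_and, Function.Embedding.coeFn_mk]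
        constructor
        · exact fun hx => ⟨W.symm ⟨x, hx⟩, by simp⟩
        · rintro ⟨k, rfl⟩
          exact (W k).2
      exact congrArg Finset.val this
    rw [degrees, hval, Multiset.map_map]
    refine Multiset.map_congr rfl fun k _ => ?_
    rw [Function.comp_apply, degree, ← Nat.card_eq_fintype_card]
    let E : Fin 4 × Fin 3 ≃ Fin T.n × Fin 3 :=
      { toFun := fun x => (A x.1, ρ x.1 x.2)
        invFun := fun y => (A.symm y.1, (ρ (A.symm y.1)).symm y.2)
        left_inv := fun x => by simp
        right_inv := fun y => by simp }
    refine (Nat.card_congr (E.subtypeEquiv fun x => ?_)).symm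
    change _ ↔ T.map (A x.1) (T.corner (A x.1) (ρ x.1 x.2)) = W k
    rw [hvert]
    exact hW.eq_iff.symm

/-- The classification of the triangulations of which all triangles are positively oriented. -/
theorem classification_of_isOriented (hH : H.IsPillowcase) (ho : T.IsOriented) :
    (T.scheme.SameType Scheme.tetrahedral ∧ T.degrees = {3, 3, 3, 3}) ∨
      (T.scheme.SameType Scheme.twoBigons ∧ T.degrees = {2, 2, 4, 4}) := by
  obtain ⟨e⟩ := hH.sphere
  have : T2Space X := e.symm.t2Space
  have hV : Fintype.card H.sing = 4 := by rw [Fintype.card_coe]; exact hH.four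
  have hX : IsPreconnected (H.sing : Set X)ᶜ :=
    isPreconnected_compl_of_homeomorph_sphere e H.sing.finite_toSet (by
      rw [Finset.coe_nonempty, ← Finset.card_pos, hH.four]; norm_num)
  obtain ⟨τ, hτ⟩ := T.exists_isGluing ho
  let G := toTriangleGluing hτ hX
  have hne : Nonempty (Fin T.n) := by
    obtain ⟨x⟩ : Nonempty H.sing := Fintype.card_pos_iff.1 (by omega)
    obtain ⟨s, -⟩ := G.vertex_surjective x
    exact ⟨s.1⟩
  have hF : Fintype.card (Fin T.n) = 4 := by
    have := G.card_faces (fun c h1 h2 => by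
      obtain ⟨p, hp⟩ := hτ.exists_potential
        (fun f hf => exists_lift_of_homeomorph_sphere e hf) h1 h2
      exact ⟨fun x => p x, hp⟩)
    omega
  rcases G.hasNames_or hF hV with h | h
  · obtain ⟨h1, h2⟩ := hτ.sameType_ofNames hX (by decide) h
    exact Or.inl ⟨h1, h2.trans (by decide)⟩
  · obtain ⟨h1, h2⟩ := hτ.sameType_ofNames hX (by decide) h
    exact Or.inr ⟨h1, h2.trans (by decide)⟩

/-! ### Orienting the triangles -/

/-- The triangulation with the corners of the triangles in another order. -/
def reorder (T : Triangulation H) (ρ : Fin T.n → Equiv.Perm (Fin 3)) : Triangulation H :=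
  have hr : ∀ i, Set.range (T.corner i ∘ ρ i) = Set.range (T.corner i) := fun i =>
    (ρ i).surjective.range_comp _
  { n := T.n
    corner := fun i => T.corner i ∘ ρ i
    nondegenerate := fun i => (T.nondegenerate i).comp_embedding (ρ i).toEmbedding
    map := T.map
    continuousOn := fun i => by rw [hr]; exact T.continuousOn i
    injOn := fun i => by rw [hr]; exact T.injOn i
    halfDilation := fun i => by rw [hr]; exact T.halfDilation i
    disjoint := fun i j => by rw [hr, hr]; exact T.disjoint i j
    cover := fun x => by simp only [hr]; exact T.cover x
    vertex_mem := fun i j => T.vertex_mem i (ρ i j)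
    sing_vertex := fun i => by rw [hr]; exact T.sing_vertex i }

theorem sameType_of_reorder {ρ : Fin T.n → Equiv.Perm (Fin 3)} {S : Scheme}
    (h : (T.reorder ρ).scheme.SameType S) : T.scheme.SameType S := by
  obtain ⟨e, σ, h1, h2⟩ := h
  refine ⟨e, fun f => (ρ f).symm.trans (σ f), fun f a g c => ?_,
    fun f a b g c d hab hcd => ?_⟩
  · obtain ⟨a, rfl⟩ := (ρ f).surjective a
    obtain ⟨c, rfl⟩ := (ρ g).surjective c
    simp only [Equiv.trans_apply, Equiv.symm_apply_apply]
    exact h1 f a g c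
  · obtain ⟨a, rfl⟩ := (ρ f).surjective a
    obtain ⟨b, rfl⟩ := (ρ f).surjective b
    obtain ⟨c, rfl⟩ := (ρ g).surjective c
    obtain ⟨d, rfl⟩ := (ρ g).surjective d
    simp only [Equiv.trans_apply, Equiv.symm_apply_apply]
    exact h2 f a b g c d (fun h => hab (congrArg _ h)) (fun h => hcd (congrArg _ h))

theorem degrees_reorder (ρ : Fin T.n → Equiv.Perm (Fin 3)) :
    (T.reorder ρ).degrees = T.degrees := by
  refine Multiset.map_congr rfl fun p _ => ?_
  let E : Fin T.n × Fin 3 ≃ Fin T.n × Fin 3 := Equiv.prodShear (Equiv.refl _) ρ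
  exact Nat.card_congr (E.subtypeEquiv fun x => Iff.rfl)

theorem exists_isOriented_reorder (T : Triangulation H) : ∃ ρ, (T.reorder ρ).IsOriented := by
  have h : ∀ i, ∃ σ : Equiv.Perm (Fin 3), ∀ j,
      0 < cross (T.corner i (σ (j + 1)) - T.corner i (σ j))
        (T.corner i (σ (j + 2)) - T.corner i (σ j)) := by
    intro i
    -- the determinant does not depend on the corner at which it is computed
    have hcyc : ∀ q : Fin 3 → ℂ, 0 < cross (q 1 - q 0) (q 2 - q 0) →
        ∀ j, 0 < cross (q (j + 1) - q j) (q (j + 2) - q j) := by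
      intro q hq j
      convert! hq using 1
      fin_cases j <;> simp [cross] <;> ring
    rcases (cross_side_ne_zero (T.nondegenerate i) 0).lt_or_gt with h | h
    · refine ⟨Equiv.swap 1 2, hcyc (T.corner i ∘ Equiv.swap 1 2) ?_⟩
      have h0 : Equiv.swap (1 : Fin 3) 2 0 = 0 := by decide
      simp only [Function.comp_apply, h0, Equiv.swap_apply_left, Equiv.swap_apply_right]
      simp only [zero_add, cross] at h ⊢
      linarith
    · exact ⟨1, hcyc (T.corner i) (by simpa using h)⟩
  choose ρ hρ using h
  exact ⟨ρ, hρ⟩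

end Triangulation

end HalfDilation

/-- A triangulation of a half-dilation pillowcase with vertices at the singularities is either
tetrahedral, with three faces around every vertex, or of the type with 2, 2, 4 and 4 faces around
the vertices; the numbers of faces 2, 3, 3 and 4 do not occur. -/
theorem proposition4p2 {X : Type*} [TopologicalSpace X]
    (H : HalfDilation.HalfDilationStructure X) (hH : H.IsPillowcase)
    (T : HalfDilation.Triangulation H) :
    ((T.scheme.SameType HalfDilation.Scheme.tetrahedral ∧ T.degrees = {3, 3, 3, 3}) ∨
      (T.scheme.SameType HalfDilation.Scheme.twoBigons ∧ T.degrees = {2, 2, 4, 4})) ∧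
    T.degrees ≠ {2, 3, 3, 4} := by
  obtain ⟨ρ, ho⟩ := T.exists_isOriented_reorder
  have h := HalfDilation.Triangulation.classification_of_isOriented hH ho
  rw [HalfDilation.Triangulation.degrees_reorder] at h
  refine ⟨h.imp (And.imp_left HalfDilation.Triangulation.sameType_of_reorder)
    (And.imp_left HalfDilation.Triangulation.sameType_of_reorder), ?_⟩
  rcases h with ⟨-, h⟩ | ⟨-, h⟩ <;> rw [h] <;> decide
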